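/- Let $n \ge 3$ be an integer and let $\mathbb{H}$ be the hyperbolic plane (of curvature $-1$). For pairwise distinct points $p, q, r \in \mathbb{H}$ let $\angle(p,q,r) \in [0,\pi]$ be the interior angle at $q$ of the hyperbolic triangle with vertices $p, q, r$ (the angle at $q$ between the geodesic segments $[q,p]$ and $[q,r]$). For a set $\mathcal{C}$ of $n$ distinct points of $\mathbb{H}$ let $\alpha_{\min}(\mathcal{C})$ be the smallest of the angles $\angle(p,q,r)$ over all triples of pairwise distinct points $p,q,r \in \mathcal{C}$, and let $\alpha_n(\mathbb{H}) = \sup_{\mathcal{C}} \alpha_{\min}(\mathcal{C})$, where $\mathcal{C}$ runs over all sets of $n$ distinct points of $\mathbb{H}$. Then: 1. For every set $\mathcal{C}$ of $n$ distinct points of $\mathbb{H}$, $\alpha_{\min}(\mathcal{C}) < \frac{\pi}{n}$. 2. For every $\varepsilon > 0$ and every $c \in \mathbb{H}$ there is a closed hyperbolic disk of positive radius with centre $c$ and area $\varepsilon$, and its boundary circle is nonempty. For every closed disk with centre $c$ and area $\varepsilon$, and for every point $p$ of its boundary circle, the images of $p$ under the rotations around $c$ by the angles $\frac{2\pi k}{n}$,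 $0 \le k < n$ (the vertices of a regular $n$-gon inscribed in the disk), are $n$ distinct points of the boundary circle, and all angles formed by triples of pairwise distinct vertices are strictly greater than $\frac{\pi}{n} - \varepsilon$. 3. $\alpha_n(\mathbb{H}) = \frac{\pi}{n}$ (in particular, the set of values $\alpha_{\min}(\mathcal{C})$ is bounded above and this is its least upper bound), and the supremum is not attained: there is no set $\mathcal{C}$ of $n$ distinct points of $\mathbb{H}$ with $\alpha_{\min}(\mathcal{C}) = \alpha_n(\mathbb{H})$. -/

import Mathlib

open scoped UpperHalfPlane Complex.UnitDisc
open scoped ComplexConjugate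

noncomputable section

namespace HypPlane

/-! The hyperbolic plane is Mathlib's upper half-plane `ℍ`, with its hyperbolic distance and its
hyperbolic area `dx dy / y ^ 2` (curvature `-1`).  Around each point `q` it is identified with the
Poincaré disk `𝔻`, with `q` at the origin. -/

lemma sub_conj_ne_zero (q z : ℍ) : (z : ℂ) - conj (q : ℂ) ≠ 0 := by
  intro h
  have := congrArg Complex.im h
  simp at this
  linarith [q.im_pos, z.im_pos]

lemma norm_toDisk_lt_one (q z : ℍ) :
    ‖((z : ℂ) - q) / ((z : ℂ) - conj (q : ℂ))‖ < 1 := by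
  have h := UpperHalfPlane.tanh_half_dist z q
  rw [Complex.dist_eq, Complex.dist_eq] at h
  rw [norm_div, ← h]
  exact Real.tanh_lt_one _

lemma fromDisk_im_pos (q : ℍ) (w : 𝔻) :
    0 < (((q : ℂ) - conj (q : ℂ) * w) / (1 - w)).im := by
  have hw : (1 - (w : ℂ)) ≠ 0 := sub_ne_zero.2 w.coe_ne_one.symm
  have h1 := w.normSq_lt_one
  have key : (((q : ℂ) - conj (q : ℂ) * w) / (1 - w)).im
      = q.im * (1 - Complex.normSq w) / Complex.normSq (1 - w) := by
    have hn : Complex.normSq (1 - (w : ℂ)) ≠ 0 := by simpa using hw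
    rw [Complex.div_im]
    field_simp
    simp [Complex.normSq_apply]
    ring
  rw [key]
  have := q.im_pos
  have h2 : 0 < Complex.normSq (1 - (w : ℂ)) := Complex.normSq_pos.2 hw
  have h3 : 0 < 1 - Complex.normSq (w : ℂ) := by linarith
  positivity

/-- The Cayley isometry `z ↦ (z - q) / (z - conj q)` of the upper half-plane onto the Poincaré
disk which moves `q` to the origin. -/
def toDisk (q : ℍ) : ℍ ≃ 𝔻 where
  toFun z := Complex.UnitDisc.mk (((z : ℂ) - q) / ((z : ℂ) - conj (q : ℂ)))
    (norm_toDisk_lt_one q z)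
  invFun w := ⟨((q : ℂ) - conj (q : ℂ) * w) / (1 - w), fromDisk_im_pos q w⟩
  left_inv z := by
    apply UpperHalfPlane.ext
    have h := sub_conj_ne_zero q z
    have h' := sub_conj_ne_zero q q
    have h3 : 1 - ((z : ℂ) - q) / ((z : ℂ) - conj (q : ℂ)) ≠ 0 := by
      rw [one_sub_div h]
      refine div_ne_zero ?_ h
      convert h' using 1
      ring
    simp only [Complex.UnitDisc.coe_mk]
    rw [div_eq_iff h3]
    field_simp
    ring
  right_inv w := by
    apply Complex.UnitDisc.coe_injective
    have hw : (1 - (w : ℂ)) ≠ 0 := sub_ne_zero.2 w.coe_ne_one.symm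
    have h := sub_conj_ne_zero q ⟨((q : ℂ) - conj (q : ℂ) * w) / (1 - w), fromDisk_im_pos q w⟩
    simp only [Complex.UnitDisc.coe_mk] at h ⊢
    rw [div_eq_iff h]
    field_simp
    ring

lemma coe_toDisk (q z : ℍ) :
    (toDisk q z : ℂ) = ((z : ℂ) - q) / ((z : ℂ) - conj (q : ℂ)) := rfl

/-- The interior angle at `q` of the hyperbolic triangle with vertices `p`, `q`, `r`.  In the
Poincaré disk centred at `q`, the sides `[q, p]` and `[q, r]` are straight segments issuing from
the origin, and hyperbolic angles are Euclidean ones.  It is used for `p ≠ q` and `r ≠ q` only. -/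
def angle (p q r : ℍ) : ℝ :=
  InnerProductGeometry.angle (toDisk q p : ℂ) (toDisk q r : ℂ)

/-- Hyperbolic law of cosines. -/
lemma cosh_dist_eq (p q r : ℍ) :
    Real.cosh (dist p r) = Real.cosh (dist q p) * Real.cosh (dist q r)
      - Real.sinh (dist q p) * Real.sinh (dist q r) * Real.cos (angle p q r) := by
  have hs : ∀ z : ℍ, Real.sinh (dist q z)
      = ‖(z : ℂ) - conj (q : ℂ)‖ ^ 2 * ‖(toDisk q z : ℂ)‖ / (2 * (z.im * q.im)) := by
    intro z
    have e : Real.sinh (dist z q) = 2 * Real.sinh (dist z q / 2) * Real.cosh (dist z q / 2) := by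
      rw [← Real.sinh_two_mul]; ring_nf
    have hn : ‖(z : ℂ) - conj (q : ℂ)‖ ≠ 0 := norm_ne_zero_iff.2 (sub_conj_ne_zero q z)
    have hp : 0 < z.im * q.im := mul_pos z.im_pos q.im_pos
    have hsq : √(z.im * q.im) * √(z.im * q.im) = z.im * q.im := Real.mul_self_sqrt hp.le
    have hs0 : √(z.im * q.im) ≠ 0 := (Real.sqrt_pos.2 hp).ne'
    rw [dist_comm, e, UpperHalfPlane.sinh_half_dist, UpperHalfPlane.cosh_half_dist, Complex.dist_eq, Complex.dist_eq, coe_toDisk,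
      norm_div]
    rw [show 2 * (z.im * q.im) = 2 * (√(z.im * q.im) * √(z.im * q.im)) by rw [hsq]]
    field_simp
  have hi := InnerProductGeometry.cos_angle_mul_norm_mul_norm (toDisk q p : ℂ) (toDisk q r : ℂ)
  have hin : ‖(p : ℂ) - conj (q : ℂ)‖ ^ 2 * ‖(r : ℂ) - conj (q : ℂ)‖ ^ 2
      * inner ℝ (toDisk q p : ℂ) (toDisk q r : ℂ)
      = (conj (((p : ℂ) - q) * conj ((p : ℂ) - conj (q : ℂ)))
          * (((r : ℂ) - q) * conj ((r : ℂ) - conj (q : ℂ)))).re := by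
    have a1 := sub_conj_ne_zero q p
    have a2 := sub_conj_ne_zero q r
    have b : ∀ z : ℍ, ((z : ℂ) - q) * conj ((z : ℂ) - conj (q : ℂ))
        = ((‖(z : ℂ) - conj (q : ℂ)‖ ^ 2 : ℝ) : ℂ) * toDisk q z := by
      intro z
      have a := sub_conj_ne_zero q z
      rw [coe_toDisk, Complex.ofReal_pow, ← Complex.mul_conj']
      field_simp
    rw [b p, b r, map_mul, Complex.conj_ofReal, Complex.inner]
    have : ∀ (s t : ℝ) (u v : ℂ), s * t * (u * conj v).re = (s * conj v * (t * u)).re := by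
      intro s t u v
      simp
      ring
    exact this _ _ _ _
  have hprod : Real.sinh (dist q p) * Real.sinh (dist q r) * Real.cos (angle p q r)
      = (conj (((p : ℂ) - q) * conj ((p : ℂ) - conj (q : ℂ)))
          * (((r : ℂ) - q) * conj ((r : ℂ) - conj (q : ℂ)))).re
        / (4 * (p.im * q.im) * (r.im * q.im)) := by
    rw [← hin, ← hi, hs, hs, angle]
    have := p.im_pos.ne'
    have := q.im_pos.ne'
    have := r.im_pos.ne'
    field_simp
    ring
  rw [hprod]
  simp only [UpperHalfPlane.cosh_dist, Complex.dist_eq, Complex.sq_norm, Complex.normSq_apply]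
  have := p.im_pos.ne'
  have := q.im_pos.ne'
  have := r.im_pos.ne'
  field_simp
  simp
  ring

/-- In the disk centred at `q`, a point between `q` and `p` lies on the straight segment from the
origin to `p`: this is the side `[q, p]` of a hyperbolic triangle. -/
lemma toDisk_mem_segment {q p z : ℍ} (h : dist q z + dist z p = dist q p) :
    (toDisk q z : ℂ) ∈ segment ℝ (0 : ℂ) (toDisk q p) := by
  have hnorm : ∀ w : ℍ, ‖(toDisk q w : ℂ)‖ = Real.tanh (dist q w / 2) := by
    intro w
    rw [dist_comm, UpperHalfPlane.tanh_half_dist, coe_toDisk, norm_div, Complex.dist_eq,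
      Complex.dist_eq]
  rcases eq_or_ne q z with rfl | hz
  · have : (toDisk q q : ℂ) = 0 := by simp [coe_toDisk]
    rw [this]
    exact left_mem_segment ℝ _ _
  have hs : 0 < dist q z := dist_pos.2 hz
  have hle : dist q z ≤ dist q p := by linarith [dist_nonneg (x := z) (y := p)]
  have hcos := cosh_dist_eq z q p
  rw [show dist z p = dist q z - dist q p + 2 * dist z p by linarith,
    show dist q z - dist q p + 2 * dist z p = dist q p - dist q z by linarith, Real.cosh_sub] at hcos
  have h1 : 0 < Real.sinh (dist q z) := Real.sinh_pos_iff.2 hs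
  have h2 : 0 < Real.sinh (dist q p) := Real.sinh_pos_iff.2 (hs.trans_le hle)
  have hc : Real.cos (angle z q p) = 1 := by
    have h3 : Real.sinh (dist q z) * Real.sinh (dist q p) * Real.cos (angle z q p)
        = Real.sinh (dist q z) * Real.sinh (dist q p) * 1 := by linarith
    exact mul_left_cancel₀ (mul_pos h1 h2).ne' h3
  have ha : angle z q p = 0 := InnerProductGeometry.cos_eq_one_iff_angle_eq_zero.1 hc
  obtain ⟨hz0, r, hr, hrz⟩ := InnerProductGeometry.angle_eq_zero_iff.1 ha
  have hn : ‖(toDisk q z : ℂ)‖ ≤ ‖(toDisk q p : ℂ)‖ := by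
    rw [hnorm, hnorm]
    rw [Real.tanh_eq_sinh_div_cosh, Real.tanh_eq_sinh_div_cosh,
      div_le_div_iff₀ (Real.cosh_pos _) (Real.cosh_pos _)]
    have h4 := Real.sinh_sub (dist q p / 2) (dist q z / 2)
    have h5 : 0 ≤ Real.sinh (dist q p / 2 - dist q z / 2) := Real.sinh_nonneg_iff.2 (by linarith)
    linarith
  have hr1 : 1 ≤ r := by
    rw [hrz, norm_smul, Real.norm_of_nonneg hr.le] at hn
    have := norm_pos_iff.2 hz0
    exact (le_mul_iff_one_le_left this).1 hn
  rw [segment_eq_image]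
  refine ⟨r⁻¹, ⟨by positivity, inv_le_one_of_one_le₀ hr1⟩, ?_⟩
  simp only [smul_zero, zero_add, hrz]
  rw [inv_smul_smul₀ hr.ne']

/-- The rotation of the hyperbolic plane by the angle `θ` around `c`. -/
def rotation (c : ℍ) (θ : ℝ) (p : ℍ) : ℍ :=
  (toDisk c).symm (Circle.exp θ • toDisk c p)

/-- The vertices of the regular `n`-gon with centre `c` and first vertex `p`: the images of `p`
under the rotations around `c` by the multiples of `2π / n`. -/
def regularPolygon (n : ℕ) (c p : ℍ) : Set ℍ :=
  Set.range fun k : Fin n => rotation c (2 * Real.pi * ((k : ℕ) : ℝ) / n) p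

/-- The angles formed by all triples of (pairwise distinct) points of `C`. -/
def angles (C : Set ℍ) : Set ℝ :=
  {θ | ∃ p ∈ C, ∃ q ∈ C, ∃ r ∈ C, p ≠ q ∧ r ≠ q ∧ p ≠ r ∧ θ = angle p q r}

/-- The smallest angle formed by the triples of `C`. -/
def minAngle (C : Set ℍ) : ℝ := sInf (angles C)

/-- The configurations of `n` (distinct) points of the hyperbolic plane. -/
def configurations (n : ℕ) : Set (Set ℍ) := {C | C.encard = n}

/-- The supremum `α_n(ℍ)` of the smallest angles of all configurations of `n` points. -/
def alpha (n : ℕ) : ℝ := sSup (minAngle '' configurations n)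

end HypPlane

end

open scoped UpperHalfPlane Complex.UnitDisc
open scoped ComplexConjugate

noncomputable section

namespace HypPlane

/-! Upper bound. In the coordinates `klein` geodesics are straight, so convex hulls are those of the
real plane, and a positive rescaling of `tangentMap` computes hyperbolic angles
(`toDisk_eq_smul_direction`). Let the hull of the `n` points have `k + 2` vertices. From each hull
vertex the other `n - 1` points are seen inside the angle of the hull there; if all angles were at
least `π / n`, that angle would be at least `(n - 2)π / n`. Summing gives at least `kπ + 2(n - k -
2)π / n ≥ kπ`, whereas a hyperbolic polygon has angle sum below `kπ` (`exists_angle_bound`, by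
cutting off triangles). If the hull is a segment, `k = 0`, the contradiction comes from `n ≥ 3`
(`exists_angle_lt`).

Sharpness. In a small disk geometry is nearly Euclidean: moving the centre of the disk model to a
vertex of a regular polygon of radius `ρ` changes the Euclidean inscribed angles, which are at least
`π / n`, by at most `π tanh² (ρ / 2)` (`inscribed_angle_ge`). This is less than the area `2π (cosh ρ
- 1)` of the disk. Since the upper bound is strict, the supremum `π / n` is not attained. -/

/-! ### Projective coordinates and angles -/

/-- Projective coordinates on the hyperbolic plane in which geodesics are straight segments. -/
def klein (z : ℍ) : ℝ × ℝ := (z.re, Complex.normSq z)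

/-- The differential of the passage from the coordinates `klein` to the disk centred at `q`, up to
a positive factor. -/
def tangentMap (q : ℍ) : ℝ × ℝ →ₗ[ℝ] ℂ where
  toFun u := (u.2 : ℂ) - 2 * q * u.1
  map_add' u v := by push_cast [Prod.fst_add, Prod.snd_add]; ring
  map_smul' c u := by
    simp only [Prod.smul_fst, Prod.smul_snd, smul_eq_mul, RingHom.id_apply, Complex.real_smul]
    push_cast; ring

lemma tangentMap_injective (q : ℍ) : Function.Injective (tangentMap q) := by
  rw [injective_iff_map_eq_zero]
  intro u hu
  have h1 := congrArg Complex.im hu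
  have h2 := congrArg Complex.re hu
  simp [tangentMap, q.im_pos.ne'] at h1 h2
  ext
  · exact h1
  · simpa [h1] using h2

lemma klein_injective : Function.Injective klein := by
  intro z w h
  have h1 : z.re = w.re := congrArg Prod.fst h
  have h2 : Complex.normSq z = Complex.normSq w := congrArg Prod.snd h
  rw [Complex.normSq_apply, Complex.normSq_apply] at h2
  simp only [UpperHalfPlane.coe_re, UpperHalfPlane.coe_im, h1] at h2
  have h3 : z.im = w.im := by nlinarith [z.im_pos, w.im_pos]
  exact UpperHalfPlane.ext (Complex.ext h1 h3)

/-- A vector at `q` pointing towards `z`. -/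
def direction (q z : ℍ) : ℂ := tangentMap q (klein z - klein q)

/-- Multiplying numerator and denominator of the Cayley map by the conjugate of the denominator
leaves `(z - q)(conj z - q) = |z|² - 2 q Re z + q²`, which is affine in `klein z` and vanishes at `z
= q`. -/
lemma toDisk_eq_smul_direction (q z : ℍ) :
    (toDisk q z : ℂ) = ((‖(z : ℂ) - conj (q : ℂ)‖ ^ 2)⁻¹ : ℝ) • direction q z := by
  have h := sub_conj_ne_zero q z
  have h' : conj ((z : ℂ) - conj (q : ℂ)) ≠ 0 := (map_ne_zero _).2 h
  rw [coe_toDisk, Complex.real_smul]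
  push_cast
  rw [← Complex.mul_conj', div_eq_iff h]
  field_simp
  have hre : ((z.re : ℝ) : ℂ) = ((z : ℂ) + conj (z : ℂ)) / 2 := by
    rw [Complex.add_conj]; simp
  have hre' : ((q.re : ℝ) : ℂ) = ((q : ℂ) + conj (q : ℂ)) / 2 := by
    rw [Complex.add_conj]; simp
  simp only [direction, tangentMap, klein, LinearMap.coe_mk, AddHom.coe_mk,
    map_sub, Complex.conj_conj, hre, hre']
  rw [← Complex.mul_conj, ← Complex.mul_conj]
  ring

lemma angle_eq_angle_direction (p q r : ℍ) :
    angle p q r = InnerProductGeometry.angle (direction q p) (direction q r) := by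
  have h : ∀ z : ℍ, 0 < (‖(z : ℂ) - conj (q : ℂ)‖ ^ 2)⁻¹ := fun z =>
    inv_pos.2 (pow_pos (norm_pos_iff.2 (sub_conj_ne_zero q z)) 2)
  rw [angle, toDisk_eq_smul_direction, toDisk_eq_smul_direction,
    InnerProductGeometry.angle_smul_left_of_pos _ _ (h p),
    InnerProductGeometry.angle_smul_right_of_pos _ _ (h r)]

lemma direction_ne_zero {q z : ℍ} (h : z ≠ q) : direction q z ≠ 0 := by
  rw [direction, Ne, map_eq_zero_iff _ (tangentMap_injective q), sub_eq_zero]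
  exact fun h' => h (klein_injective h')

lemma angle_comm (p q r : ℍ) : angle p q r = angle r q p :=
  InnerProductGeometry.angle_comm _ _

lemma angle_self_of_ne {p q : ℍ} (h : p ≠ q) : angle p q p = 0 := by
  rw [angle_eq_angle_direction]
  exact InnerProductGeometry.angle_self (direction_ne_zero h)

lemma angle_nonneg (p q r : ℍ) : 0 ≤ angle p q r := InnerProductGeometry.angle_nonneg _ _

lemma angle_le_pi (p q r : ℍ) : angle p q r ≤ Real.pi := InnerProductGeometry.angle_le_pi _ _

lemma angle_le_add (q x y z : ℍ) : angle x q z ≤ angle x q y + angle y q z :=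
  InnerProductGeometry.angle_le_angle_add_angle _ _ _

/-! ### Angular coordinates in a half-plane -/

lemma abs_arg_lt_of_re_pos {x : ℂ} (hx : 0 < x.re) : |x.arg| < Real.pi / 2 :=
  Complex.abs_arg_lt_pi_div_two_iff.2 (Or.inl hx)

lemma ne_zero_of_re_pos {x : ℂ} (hx : 0 < x.re) : x ≠ 0 := by
  rintro rfl; simp at hx

/-- The tangent is increasing on `(-π/2, π/2)`, so the order of arguments is the sign of a cross
product, a condition linear in each vector. -/
lemma arg_lt_arg_iff_of_re_pos {x y : ℂ} (hx : 0 < x.re) (hy : 0 < y.re) :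
    x.arg < y.arg ↔ 0 < x.re * y.im - x.im * y.re := by
  have h1 := abs_lt.1 (abs_arg_lt_of_re_pos hx)
  have h2 := abs_lt.1 (abs_arg_lt_of_re_pos hy)
  rw [← Real.strictMonoOn_tan.lt_iff_lt (by constructor <;> linarith) (by constructor <;> linarith),
    Complex.tan_arg, Complex.tan_arg, div_lt_div_iff₀ hx hy]
  constructor <;> intro h <;> linarith

lemma angle_eq_abs_sub_arg {x y : ℂ} (hx : 0 < x.re) (hy : 0 < y.re) :
    InnerProductGeometry.angle x y = |x.arg - y.arg| := by
  have hx0 := ne_zero_of_re_pos hx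
  have hy0 := ne_zero_of_re_pos hy
  have h1 := abs_lt.1 (abs_arg_lt_of_re_pos hx)
  have h2 := abs_lt.1 (abs_arg_lt_of_re_pos hy)
  have hi : y⁻¹.arg = -y.arg := by
    rw [Complex.arg_inv, if_neg]
    intro h; linarith [Real.pi_pos]
  rw [Complex.angle_eq_abs_arg hx0 hy0, div_eq_mul_inv,
    (Complex.arg_mul_eq_add_arg_iff hx0 (inv_ne_zero hy0)).2, hi, sub_eq_add_neg]
  rw [hi]
  constructor <;> linarith

lemma exists_mul_re_pos {Y : Set ℂ} (hY : Y.Finite) (h0 : (0 : ℂ) ∉ convexHull ℝ Y) :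
    ∃ ω : ℂ, ω ≠ 0 ∧ ∀ z ∈ convexHull ℝ Y, 0 < (ω * z).re := by
  rcases Y.eq_empty_or_nonempty with rfl | hne
  · exact ⟨1, one_ne_zero, by simp⟩
  obtain ⟨f, u, hu, hf⟩ := geometric_hahn_banach_point_closed (convex_convexHull ℝ Y)
    (hY.isClosed_convexHull ℝ) h0
  -- Every real functional on `ℂ` is `z ↦ Re (ω z)`, so the separating half-plane can be turned into
  -- the right half-plane.
  have key : ∀ z, (((f 1 : ℂ) - f Complex.I * Complex.I) * z).re = f z := by
    intro z
    have : z = z.re • (1 : ℂ) + z.im • Complex.I := by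
      simp
    conv_rhs => rw [this, map_add, map_smul, map_smul]
    simp
    ring
  have hpos : ∀ z ∈ convexHull ℝ Y, 0 < (((f 1 : ℂ) - f Complex.I * Complex.I) * z).re := by
    intro z hz
    rw [key]
    have := hf z hz
    rw [map_zero] at hu
    linarith
  refine ⟨_, ?_, hpos⟩
  intro h
  obtain ⟨y, hy⟩ := hne
  have := hpos y (subset_convexHull ℝ _ hy)
  rw [h] at this
  simp at this

/-- If all of `Y` lay strictly on one side of the line through `0` and `z`, so would its hull, and
hence `z` itself. -/
lemma exists_arg_le_of_mem_convexHull {Y : Set ℂ} (hY : ∀ y ∈ convexHull ℝ Y, 0 < y.re) {z : ℂ}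
    (hz : z ∈ convexHull ℝ Y) : (∃ y ∈ Y, y.arg ≤ z.arg) ∧ ∃ y ∈ Y, z.arg ≤ y.arg := by
  have hlin : ∀ a b : ℝ, Convex ℝ {y : ℂ | 0 < a * y.re + b * y.im} := by
    intro a b
    apply convex_halfSpace_gt
    constructor
    · intro x y; simp; ring
    · intro c x; simp; ring
  constructor
  · by_contra! h
    have hs : Y ⊆ {y : ℂ | 0 < (-z.im) * y.re + z.re * y.im} := by
      intro y hy
      have := (arg_lt_arg_iff_of_re_pos (hY z hz) (hY y (subset_convexHull ℝ _ hy))).1 (h y hy)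
      simp only [Set.mem_ofPred_eq]; linarith
    have := convexHull_min hs (hlin _ _) hz
    simp only [Set.mem_ofPred_eq] at this
    linarith
  · by_contra! h
    have hs : Y ⊆ {y : ℂ | 0 < z.im * y.re + (-z.re) * y.im} := by
      intro y hy
      have := (arg_lt_arg_iff_of_re_pos (hY y (subset_convexHull ℝ _ hy)) (hY z hz)).1 (h y hy)
      simp only [Set.mem_ofPred_eq]; linarith
    have := convexHull_min hs (hlin _ _) hz
    simp only [Set.mem_ofPred_eq] at this
    linarith

/-- The points seen from `v` in the directions of the convex hull of `T`. -/
def cone (v : ℍ) (T : Finset ℍ) : Set ℍ :=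
  {p | ∃ c : ℝ, 0 < c ∧ ∃ y ∈ convexHull ℝ (klein '' T), klein p - klein v = c • (y - klein v)}

lemma mem_cone_of_mem {v p : ℍ} {T : Finset ℍ} (hp : p ∈ T) : p ∈ cone v T :=
  ⟨1, one_pos, klein p, subset_convexHull ℝ _ ⟨p, hp, rfl⟩, (one_smul _ _).symm⟩

/-- An angular coordinate around a point `v` outside the convex hull of `T`. -/
lemma exists_angular_coordinate {v : ℍ} {T : Finset ℍ}
    (h : klein v ∉ convexHull ℝ (klein '' T)) :
    ∃ t : ℍ → ℝ, (∀ p ∈ cone v T, |t p| < Real.pi / 2) ∧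
      (∀ p ∈ cone v T, ∀ r ∈ cone v T, angle p v r = |t p - t r|) ∧
      (∀ p ∈ cone v T, (∃ y ∈ T, t y ≤ t p) ∧ ∃ y ∈ T, t p ≤ t y) ∧
      (∀ p ∈ cone v T, ∀ q ∈ cone v T, ∀ r ∈ cone v T, t p ≤ t q → t q ≤ t r → t p < t r →
        ∃ a b : ℝ, 0 ≤ a ∧ 0 ≤ b ∧
          klein q - klein v = a • (klein p - klein v) + b • (klein r - klein v)) ∧
      (∀ p ∈ cone v T, ∀ q ∈ cone v T, t p = t q →
        ∃ c : ℝ, 0 < c ∧ klein p - klein v = c • (klein q - klein v)) := by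
  let φ : ℝ × ℝ →ᵃ[ℝ] ℂ := (tangentMap v).toAffineMap.comp
    (AffineMap.id ℝ (ℝ × ℝ) - AffineMap.const ℝ (ℝ × ℝ) (klein v))
  have hφ : ∀ y, φ y = tangentMap v (y - klein v) := fun y => rfl
  have himg : φ '' convexHull ℝ (klein '' T) = convexHull ℝ (direction v '' T) := by
    rw [AffineMap.image_convexHull, Set.image_image]
    rfl
  have h0 : (0 : ℂ) ∉ convexHull ℝ (direction v '' T) := by
    rw [← himg]
    rintro ⟨y, hy, hy0⟩
    rw [hφ, map_eq_zero_iff _ (tangentMap_injective v), sub_eq_zero] at hy0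
    exact h (hy0 ▸ hy)
  obtain ⟨ω, hω, hpos⟩ := exists_mul_re_pos (T.finite_toSet.image _) h0
  have hmul : ∀ Z : Set ℂ, (fun z => ω * z) '' convexHull ℝ Z
      = convexHull ℝ ((fun z => ω * z) '' Z) := fun Z =>
    (LinearMap.mulLeft ℝ ω).image_convexHull Z
  have hcone : ∀ p ∈ cone v T, ∃ c : ℝ, 0 < c ∧ ∃ z ∈ convexHull ℝ (direction v '' T),
      ω * direction v p = c * (ω * z) := by
    rintro p ⟨c, hc, y, hy, e⟩
    refine ⟨c, hc, φ y, himg ▸ Set.mem_image_of_mem _ hy, ?_⟩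
    rw [direction, e, map_smul, hφ, Complex.real_smul]
    ring
  have hre : ∀ p ∈ cone v T, 0 < (ω * direction v p).re := by
    intro p hp
    obtain ⟨c, hc, z, hz, e⟩ := hcone p hp
    rw [e, Complex.re_ofReal_mul]
    exact mul_pos hc (hpos z hz)
  have hle : ∀ p ∈ cone v T, ∀ q ∈ cone v T,
      ((ω * direction v p).arg ≤ (ω * direction v q).arg ↔
      0 ≤ (ω * direction v p).re * (ω * direction v q).im
        - (ω * direction v p).im * (ω * direction v q).re) := by
    intro p hp q hq
    rw [← not_lt, arg_lt_arg_iff_of_re_pos (hre q hq) (hre p hp), not_lt]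
    constructor <;> intro h <;> linarith
  refine ⟨fun p => (ω * direction v p).arg, fun p hp => abs_arg_lt_of_re_pos (hre p hp),
    ?_, ?_, ?_, ?_⟩
  · intro p hp r hr
    rw [angle_eq_angle_direction, ← Complex.angle_mul_left hω]
    exact angle_eq_abs_sub_arg (hre p hp) (hre r hr)
  · intro p hp
    obtain ⟨c, hc, z, hz, e⟩ := hcone p hp
    have hz' : ω * z ∈ convexHull ℝ ((fun z => ω * z) '' (direction v '' T)) := by
      rw [← hmul]; exact Set.mem_image_of_mem _ hz
    have := exists_arg_le_of_mem_convexHull (Y := (fun z => ω * z) '' (direction v '' T)) (by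
      rw [← hmul]
      rintro _ ⟨y, hy, rfl⟩
      exact hpos y hy) hz'
    simpa [e, Complex.arg_real_mul _ hc] using this
  · intro p hp q hq r hr hpq hqr hpr
    have h1 := (hle p hp q hq).1 hpq
    have h2 := (hle q hq r hr).1 hqr
    have h3 := (arg_lt_arg_iff_of_re_pos (hre p hp) (hre r hr)).1 hpr
    -- Cramer's rule: the coefficients are quotients of cross products, whose signs are known from
    -- the order of the arguments.
    refine ⟨_, _, div_nonneg h2 h3.le, div_nonneg h1 h3.le, ?_⟩
    apply tangentMap_injective v
    apply mul_left_cancel₀ hω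
    change ω * direction v q = _
    rw [map_add, map_smul, map_smul]
    change _ = ω * (_ • direction v p + _ • direction v r)
    rw [mul_add, mul_smul_comm, mul_smul_comm]
    set x := ω * direction v p
    set y := ω * direction v q
    set z := ω * direction v r
    apply Complex.ext
    · simp only [Complex.add_re, Complex.smul_re, smul_eq_mul]
      rw [div_mul_eq_mul_div, div_mul_eq_mul_div, ← add_div, eq_div_iff h3.ne']
      ring
    · simp only [Complex.add_im, Complex.smul_im, smul_eq_mul]
      rw [div_mul_eq_mul_div, div_mul_eq_mul_div, ← add_div, eq_div_iff h3.ne']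
      ring
  · intro p hp q hq hpq
    have h1 := (hle p hp q hq).1 hpq.le
    have h2 := (hle q hq p hp).1 hpq.ge
    refine ⟨_, div_pos (hre p hp) (hre q hq), ?_⟩
    apply tangentMap_injective v
    apply mul_left_cancel₀ hω
    change ω * direction v p = _
    rw [map_smul]
    change _ = ω * (_ • direction v q)
    rw [mul_smul_comm]
    have h4 := hre p hp
    have h3 := hre q hq
    set x := ω * direction v p
    set y := ω * direction v q
    apply Complex.ext
    · simp only [Complex.smul_re, smul_eq_mul]
      field_simp
    · simp only [Complex.smul_im, smul_eq_mul]
      rw [div_mul_eq_mul_div, eq_div_iff h3.ne']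
      linarith

/-! ### Angle sum of a triangle -/

/-- A consequence of the second hyperbolic law of cosines. -/
lemma cos_pi_sub_lt {p q r : ℍ} (hpq : p ≠ q) (hpr : p ≠ r) (hqr : q ≠ r)
    (h0 : 0 < Real.sin (angle p q r)) :
    Real.cos (Real.pi - (angle q p r + angle p q r)) < Real.cos (angle p r q) := by
  have e1 := cosh_dist_eq p q r
  have e2 := cosh_dist_eq q p r
  have e3 := cosh_dist_eq p r q
  rw [dist_comm q p] at e1
  rw [dist_comm r p, dist_comm r q] at e3
  have sa : 0 < Real.sinh (dist q r) := Real.sinh_pos_iff.2 (dist_pos.2 hqr)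
  have sb : 0 < Real.sinh (dist p r) := Real.sinh_pos_iff.2 (dist_pos.2 hpr)
  have sc : 0 < Real.sinh (dist p q) := Real.sinh_pos_iff.2 (dist_pos.2 hpq)
  have hC : 1 < Real.cosh (dist p q) := Real.one_lt_cosh.2 (dist_pos.2 hpq).ne'
  have ha := Real.cosh_sq (dist q r)
  have hb := Real.cosh_sq (dist p r)
  have hc := Real.cosh_sq (dist p q)
  have t1 := Real.sin_sq_add_cos_sq (angle p q r)
  have t2 := Real.sin_sq_add_cos_sq (angle q p r)
  have n2 : 0 ≤ Real.sin (angle q p r) :=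
    Real.sin_nonneg_of_nonneg_of_le_pi (angle_nonneg _ _ _) (angle_le_pi _ _ _)
  rw [Real.cos_pi_sub, Real.cos_add]
  generalize Real.cosh (dist q r) = A at *
  generalize Real.cosh (dist p r) = B at *
  generalize Real.cosh (dist p q) = C at *
  generalize Real.sinh (dist q r) = a at *
  generalize Real.sinh (dist p r) = b at *
  generalize Real.sinh (dist p q) = c at *
  generalize Real.sin (angle p q r) = sq at *
  generalize Real.sin (angle q p r) = sp at *
  generalize Real.cos (angle p q r) = q' at *
  generalize Real.cos (angle q p r) = p' at *
  generalize Real.cos (angle p r q) = r' at *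
  -- `D` is the Gram determinant of the triangle. Expressing it through the angle at `q` and through
  -- the angle at `p` gives the law of sines `d3`.
  obtain ⟨D, hD⟩ : ∃ D, D = 1 - A ^ 2 - B ^ 2 - C ^ 2 + 2 * A * B * C := ⟨_, rfl⟩
  have d1 : (sq * (c * a)) ^ 2 = D := by
    have : (c * a * q') = C * A - B := by linarith
    calc (sq * (c * a)) ^ 2 = c ^ 2 * a ^ 2 - (c * a * q') ^ 2 := by
          linear_combination (c * a) ^ 2 * t1
      _ = D := by rw [this, hD]; linear_combination (1 - A ^ 2) * hc - c ^ 2 * ha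
  have d2 : (sp * (c * b)) ^ 2 = D := by
    have : (c * b * p') = C * B - A := by linarith
    calc (sp * (c * b)) ^ 2 = c ^ 2 * b ^ 2 - (c * b * p') ^ 2 := by
          linear_combination (c * b) ^ 2 * t2
      _ = D := by rw [this, hD]; linear_combination (1 - B ^ 2) * hc - c ^ 2 * hb
  have d3 : sq * (c * a) = sp * (c * b) :=
    (sq_eq_sq₀ (by positivity) (by positivity)).1 (d1.trans d2.symm)
  have hDpos : 0 < D := by rw [← d1]; positivity
  have d4 : sp * sq * (c ^ 2 * a * b) = D := by
    rw [← d1]; linear_combination -(sq * (c * a)) * d3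
  -- With `D` written as in `d4`, this is the second law of cosines `cos r = -cos p cos q + sin p
  -- sin q cosh (dist p q)`; strictness comes from `cosh (dist p q) > 1`.
  have key : (r' + p' * q' - sp * sq) * (c ^ 2 * a * b) = (C - 1) * D := by
    have k1 : b * a * r' = B * A - C := by linarith
    have k2 : c * b * p' = C * B - A := by linarith
    have k3 : c * a * q' = C * A - B := by linarith
    calc (r' + p' * q' - sp * sq) * (c ^ 2 * a * b)
        = c ^ 2 * (b * a * r') + (c * b * p') * (c * a * q') - sp * sq * (c ^ 2 * a * b) := by ring
      _ = (C - 1) * D := by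
          rw [k1, k2, k3, d4, hD]; linear_combination -(B * A - C) * hc
  have : 0 < (r' + p' * q' - sp * sq) * (c ^ 2 * a * b) := by
    rw [key]; exact mul_pos (by linarith) hDpos
  have := pos_of_mul_pos_left this (by positivity)
  linarith

/-- The absolute value keeps the argument in `[0, π]`, where the cosine is decreasing, as the sum of
two angles is not yet known to be at most `π`. -/
lemma angle_lt_abs {p q r : ℍ} (hpq : p ≠ q) (hpr : p ≠ r) (hqr : q ≠ r)
    (h0 : 0 < Real.sin (angle p q r)) :
    angle p r q < |Real.pi - (angle q p r + angle p q r)| := by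
  have h := cos_pi_sub_lt hpq hpr hqr h0
  rw [← Real.cos_abs (Real.pi - _)] at h
  have b1 := angle_nonneg q p r
  have b2 := angle_nonneg p q r
  have b3 := angle_le_pi q p r
  have b4 := angle_le_pi p q r
  refine (Real.strictAntiOn_cos.lt_iff_gt ⟨abs_nonneg _, ?_⟩
    ⟨angle_nonneg _ _ _, angle_le_pi _ _ _⟩).1 h
  rw [abs_le]; constructor <;> linarith

/-- The angle sum of a nondegenerate hyperbolic triangle is less than `π`. -/
lemma angle_sum_lt_pi {p q r : ℍ} (hpq : p ≠ q) (hpr : p ≠ r) (hqr : q ≠ r)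
    (h0 : 0 < angle p q r) (h1 : angle p q r < Real.pi) :
    angle p q r + angle q p r + angle p r q < Real.pi := by
  have hs := Real.sin_pos_of_pos_of_lt_pi h0 h1
  have e1 := angle_lt_abs hpq hpr hqr hs
  -- The same inequality with `p` and `r` exchanged. If both absolute values were attained with the
  -- negative sign, adding them would give `angle p q r > π`.
  have e2 := angle_lt_abs hqr.symm hpr.symm hpq.symm (by rwa [angle_comm])
  rw [angle_comm r q p, angle_comm r p q, angle_comm q r p] at e2
  have b1 := angle_le_pi p q r
  rw [lt_abs] at e1 e2
  rcases e1 with e1 | e1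
  · linarith
  rcases e2 with e2 | e2
  · linarith
  · linarith

/-! ### Convex polygons and the upper bound -/

/-- Real numbers with mutual distances at least `δ` spread over at least `card - 1` times `δ`. -/
lemma exists_sub_ge_of_separated {ι : Type*} [DecidableEq ι] (t : ι → ℝ) (δ : ℝ) (k : ℕ) :
    ∀ T : Finset ι, T.card = k + 1 →
      (∀ p ∈ T, ∀ r ∈ T, p ≠ r → δ ≤ |t p - t r|) →
      ∃ p ∈ T, ∃ r ∈ T, k * δ ≤ t p - t r := by
  induction k with
  | zero =>
    intro T hT _
    obtain ⟨p, rfl⟩ := Finset.card_eq_one.1 hT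
    exact ⟨p, by simp, p, by simp, by simp⟩
  | succ k ih =>
    intro T hT hsep
    obtain ⟨m, hm, hmax⟩ := T.exists_max_image t (Finset.card_pos.1 (by omega))
    obtain ⟨p, hp, r, hr, hk⟩ := ih (T.erase m) (by rw [Finset.card_erase_of_mem hm]; omega)
      (fun p hp r hr => hsep p (Finset.mem_of_mem_erase hp) r (Finset.mem_of_mem_erase hr))
    refine ⟨m, hm, r, Finset.mem_of_mem_erase hr, ?_⟩
    have h1 := hsep m hm p (Finset.mem_of_mem_erase hp) (Finset.ne_of_mem_erase hp).symm
    rw [abs_of_nonneg (sub_nonneg.2 (hmax p (Finset.mem_of_mem_erase hp)))] at h1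
    push_cast
    linarith

open Classical in
/-- No point lies in the convex hull of the others. -/
def ConvexPosition (S : Finset ℍ) : Prop :=
  ∀ v ∈ S, klein v ∉ convexHull ℝ (klein '' (S.erase v : Finset ℍ))

open Classical in
lemma ConvexPosition.erase {S : Finset ℍ} (h : ConvexPosition S) (w : ℍ) :
    ConvexPosition (S.erase w) := by
  intro v hv hmem
  refine h v (Finset.mem_of_mem_erase hv) (convexHull_mono (Set.image_mono ?_) hmem)
  exact_mod_cast Finset.erase_subset_erase v (Finset.erase_subset w S)

-- A point in the hull of the others can be discarded without changing the hull; this stops at a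
-- subset in convex position.
open Classical in
lemma exists_convexPosition (C : Finset ℍ) :
    ∃ H ⊆ C, ConvexPosition H ∧ klein '' C ⊆ convexHull ℝ (klein '' H) := by
  induction C using Finset.strongInduction with
  | H C ih =>
    by_cases h : ConvexPosition C
    · exact ⟨C, subset_rfl, h, subset_convexHull ℝ _⟩
    · simp only [ConvexPosition, not_forall, not_not] at h
      obtain ⟨v, hv, hmem⟩ := h
      obtain ⟨H, hH, hc, hsub⟩ := ih _ (Finset.erase_ssubset hv)
      refine ⟨H, hH.trans (Finset.erase_subset _ _), hc, ?_⟩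
      rintro _ ⟨x, hx, rfl⟩
      by_cases hxv : x = v
      · subst hxv
        exact convexHull_min hsub (convex_convexHull ℝ _) hmem
      · exact hsub ⟨x, Finset.mem_coe.2 (Finset.mem_erase.2 ⟨hxv, hx⟩), rfl⟩

/-- Of two points on the same ray from `w`, the nearer one lies on the segment from `w` to the
farther one. -/
lemma not_aligned_of_notMem {w p r : ℍ} {Y Z : Set (ℝ × ℝ)} (hY : klein p ∉ convexHull ℝ Y)
    (hZ : klein r ∉ convexHull ℝ Z) (hwY : klein w ∈ Y) (hwZ : klein w ∈ Z)
    (hr : klein r ∈ Y) (hp : klein p ∈ Z) :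
    ¬ ∃ c : ℝ, 0 < c ∧ klein p - klein w = c • (klein r - klein w) := by
  rintro ⟨c, hc, e⟩
  rcases le_total c 1 with h1 | h1
  · refine hY (segment_subset_convexHull hwY hr ?_)
    rw [segment_eq_image']
    exact ⟨c, ⟨hc.le, h1⟩, by simp [← e]⟩
  · refine hZ (segment_subset_convexHull hwZ hp ?_)
    rw [segment_eq_image']
    exact ⟨c⁻¹, ⟨by positivity, inv_le_one_of_one_le₀ h1⟩, by
      simp [e, inv_smul_smul₀ hc.ne']⟩

open Classical in
/-- In convex position, every point `w` has two extreme neighbours `u` and `u'`. -/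
lemma ConvexPosition.exists_neighbours {S : Finset ℍ} (h : ConvexPosition S) {w : ℍ}
    (hw : w ∈ S) (hcard : 3 ≤ S.card) :
    ∃ u ∈ S.erase w, ∃ u' ∈ S.erase w, u ≠ u' ∧
      0 < angle u w u' ∧ angle u w u' < Real.pi ∧
      (∀ p ∈ S.erase w, ∀ r ∈ S.erase w, angle p w r ≤ angle u w u') ∧
      ∀ v ∈ S.erase w, v ≠ u → v ≠ u' → w ∈ cone v ((S.erase w).erase v) := by
  obtain ⟨t, hlt, hang, -, hcr, heq⟩ := exists_angular_coordinate (h w hw)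
  have hcard' : 2 ≤ (S.erase w).card := by rw [Finset.card_erase_of_mem hw]; omega
  have hne : (S.erase w).Nonempty := Finset.card_pos.1 (by omega)
  obtain ⟨u, hu, hmin⟩ := (S.erase w).exists_min_image t hne
  obtain ⟨u', hu', hmax⟩ := (S.erase w).exists_max_image t hne
  have hm : ∀ {p}, p ∈ S.erase w → p ∈ cone w (S.erase w) := mem_cone_of_mem
  have hinj : ∀ p ∈ S.erase w, ∀ r ∈ S.erase w, p ≠ r → t p ≠ t r := by
    intro p hp r hr hpr e
    have mem : ∀ {x y}, x ∈ S → x ≠ y → klein x ∈ klein '' (S.erase y : Finset ℍ) :=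
      fun hx hxy => ⟨_, Finset.mem_coe.2 (Finset.mem_erase.2 ⟨hxy, hx⟩), rfl⟩
    have hp' := Finset.mem_erase.1 hp
    have hr' := Finset.mem_erase.1 hr
    exact not_aligned_of_notMem (h p hp'.2) (h r hr'.2) (mem hw hp'.1.symm) (mem hw hr'.1.symm)
      (mem hr'.2 hpr.symm) (mem hp'.2 hpr) (heq p (hm hp) r (hm hr) e)
  have htlt : t u < t u' := by
    obtain ⟨p, hp, r, hr, hpr⟩ := Finset.one_lt_card.1 hcard'
    by_contra hcon
    apply hinj p hp r hr hpr
    linarith [hmin p hp, hmin r hr, hmax p hp, hmax r hr]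
  have huu : u ≠ u' := fun e => by rw [e] at htlt; exact lt_irrefl _ htlt
  have ha : angle u w u' = t u' - t u := by
    rw [hang u (hm hu) u' (hm hu'), abs_sub_comm, abs_of_pos (by linarith)]
  have b1 := abs_lt.1 (hlt u (hm hu))
  have b2 := abs_lt.1 (hlt u' (hm hu'))
  refine ⟨u, hu, u', hu', huu, by linarith, by linarith, ?_, ?_⟩
  · intro p hp r hr
    rw [ha, hang p (hm hp) r (hm hr), abs_le]
    constructor <;> linarith [hmin p hp, hmin r hr, hmax p hp, hmax r hr]
  · intro v hv hvu hvu'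
    obtain ⟨a, b, h0a, h0b, e⟩ := hcr u (hm hu) v (hm hv) u' (hm hu') (hmin v hv) (hmax v hv) htlt
    have hv' := Finset.mem_erase.1 hv
    have mem : ∀ {x}, x ∈ S → x ≠ v → klein x ∈ klein '' (S.erase v : Finset ℍ) :=
      fun hx hxy => ⟨_, Finset.mem_coe.2 (Finset.mem_erase.2 ⟨hxy, hx⟩), rfl⟩
    have e' : klein v = a • klein u + b • klein u' + (1 - a - b) • klein w := by
      rw [sub_eq_iff_eq_add] at e
      rw [e]; module
    -- Otherwise `v` would lie in the triangle with vertices `u`, `u'`, `w`.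
    have hab : 1 < a + b := by
      by_contra hcon
      refine h v hv'.2 ?_
      have hx := convex_convexHull ℝ (klein '' (S.erase v : Finset ℍ))
      have := hx.sum_mem (t := Finset.univ) (w := ![a, b, 1 - a - b])
        (z := ![klein u, klein u', klein w]) (by
          intro i _; fin_cases i
          · exact h0a
          · exact h0b
          · change 0 ≤ 1 - a - b; linarith) (by simp [Fin.sum_univ_three]) (by
          intro i _
          apply subset_convexHull
          fin_cases i
          · exact mem (Finset.mem_of_mem_erase hu) hvu.symm
          · exact mem (Finset.mem_of_mem_erase hu') hvu'.symm
          · exact mem hw hv'.1.symm)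
      rw [e']
      simpa [Fin.sum_univ_three] using this
    have hab0 : a + b ≠ 0 := by linarith
    have hab1 : a + b - 1 ≠ 0 := by linarith
    -- The ray from `w` to `v` meets the segment from `u` to `u'` at `y = (a u + b u') / (a + b)`,
    -- between `w` and `v` because `a + b > 1`. Solving `w - v = c (y - v)` gives the factor.
    refine ⟨(a + b) / (a + b - 1), div_pos (by linarith) (by linarith),
      (a / (a + b)) • klein u + (b / (a + b)) • klein u', ?_, ?_⟩
    · refine convex_convexHull ℝ _ ?_ ?_ (by positivity) (by positivity) (by field_simp)
      · exact subset_convexHull ℝ _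
          ⟨u, Finset.mem_coe.2 (Finset.mem_erase.2 ⟨hvu.symm, hu⟩), rfl⟩
      · exact subset_convexHull ℝ _
          ⟨u', Finset.mem_coe.2 (Finset.mem_erase.2 ⟨hvu'.symm, hu'⟩), rfl⟩
    · rw [e']
      match_scalars <;> field_simp <;> ring

open Classical in
/-- The angle sum of a convex hyperbolic polygon with `k` vertices is less than `(k - 2)π`. -/
lemma exists_angle_bound (k : ℕ) :
    ∀ S : Finset ℍ, ConvexPosition S → S.card = k + 2 → ∃ A : ℍ → ℝ,
      (∀ v ∈ S, ∀ p ∈ S.erase v, ∀ r ∈ S.erase v, angle p v r ≤ A v) ∧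
      ∑ v ∈ S, A v ≤ k * Real.pi ∧ (0 < k → ∑ v ∈ S, A v < k * Real.pi) := by
  induction k with
  | zero =>
    intro S _ hS
    refine ⟨0, ?_, by simp, by simp⟩
    intro v hv p hp r hr
    have h1 : (S.erase v).card = 1 := by rw [Finset.card_erase_of_mem hv]; omega
    obtain ⟨x, hx⟩ := Finset.card_eq_one.1 h1
    have hpv := Finset.ne_of_mem_erase hp
    rw [hx, Finset.mem_singleton] at hp hr
    rw [hr, ← hp, angle_self_of_ne hpv]
    simp
  | succ k ih =>
    intro S hS hcard
    obtain ⟨w, hw⟩ : S.Nonempty := Finset.card_pos.1 (by omega)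
    obtain ⟨u, hu, u', hu', huu, hpos, hlt, hmax, hcone⟩ := hS.exists_neighbours hw (by omega)
    obtain ⟨A, hA, hsum, -⟩ := ih (S.erase w) (hS.erase w)
      (by rw [Finset.card_erase_of_mem hw]; omega)
    have huw := Finset.ne_of_mem_erase hu
    have huw' := Finset.ne_of_mem_erase hu'
    have htri := angle_sum_lt_pi huw huu huw'.symm hpos hlt
    -- Gluing the triangle `w u u'` to the polygon without `w` enlarges the bounds only at `u` and
    -- `u'` and adds the angle at `w`; in total less than `π`.
    let B : ℍ → ℝ := fun v => if v = w then angle u w u' else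
      A v + ((if v = u then angle w u u' else 0) + (if v = u' then angle u u' w else 0))
    have hsumB : ∑ v ∈ S, B v < ((k + 1 : ℕ) : ℝ) * Real.pi := by
      rw [← Finset.add_sum_erase S B hw]
      have : ∑ v ∈ S.erase w, B v = ∑ v ∈ S.erase w, (A v +
          ((if v = u then angle w u u' else 0) + (if v = u' then angle u u' w else 0))) :=
        Finset.sum_congr rfl fun v hv => if_neg (Finset.ne_of_mem_erase hv)
      rw [this, Finset.sum_add_distrib, Finset.sum_add_distrib, Finset.sum_ite_eq',
        Finset.sum_ite_eq', if_pos hu, if_pos hu']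
      simp only [B, if_true]
      push_cast
      linarith
    refine ⟨B, ?_, hsumB.le, fun _ => hsumB⟩
    intro v hv
    by_cases hvw : v = w
    · subst hvw
      simpa [B] using hmax
    have hvT : v ∈ S.erase w := Finset.mem_erase.2 ⟨hvw, hv⟩
    have hAB : A v ≤ B v := by
      simp only [B, if_neg hvw]
      have : 0 ≤ if v = u then angle w u u' else 0 := by
        split_ifs; exacts [angle_nonneg _ _ _, le_rfl]
      have : 0 ≤ if v = u' then angle u u' w else 0 := by
        split_ifs; exacts [angle_nonneg _ _ _, le_rfl]
      linarith
    have hwr : ∀ r ∈ (S.erase w).erase v, angle w v r ≤ B v := by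
      intro r hr
      by_cases hvu : v = u
      · subst hvu
        have h1 := angle_le_add v w u' r
        have h2 := hA v hvT u' (Finset.mem_erase.2 ⟨huu.symm, hu'⟩) r hr
        have h3 : B v = A v + angle w v u' := by simp [B, hvw, huu]
        linarith
      by_cases hvu' : v = u'
      · subst hvu'
        have h1 := angle_le_add v w u r
        have h2 := hA v hvT u (Finset.mem_erase.2 ⟨huu, hu⟩) r hr
        have h3 : B v = A v + angle u v w := by simp [B, hvw, huu.symm]
        rw [angle_comm w v u] at h1
        linarith
      -- At any other vertex the direction of `w` lies between directions of remaining vertices, so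
      -- the old bound still applies.
      obtain ⟨t, -, hang, hbet, -⟩ := exists_angular_coordinate (hS.erase w v hvT)
      have hc := hcone v hvT hvu hvu'
      obtain ⟨⟨y, hy, hyt⟩, z, hz, hzt⟩ := hbet w hc
      rw [hang w hc r (mem_cone_of_mem hr)]
      have h1 := hA v hvT y hy r hr
      have h2 := hA v hvT z hz r hr
      rw [hang y (mem_cone_of_mem hy) r (mem_cone_of_mem hr), abs_le] at h1
      rw [hang z (mem_cone_of_mem hz) r (mem_cone_of_mem hr), abs_le] at h2
      rw [abs_le]
      constructor <;> linarith
    have hcases : ∀ x ∈ S.erase v, x = w ∨ x ∈ (S.erase w).erase v := by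
      intro x hx
      rw [Finset.mem_erase] at hx
      by_cases hxw : x = w
      · exact Or.inl hxw
      · exact Or.inr (Finset.mem_erase.2 ⟨hx.1, Finset.mem_erase.2 ⟨hxw, hx.2⟩⟩)
    intro p hp r hr
    rcases hcases p hp with rfl | hp'
    · rcases hcases r hr with rfl | hr'
      · rw [angle_self_of_ne (Ne.symm hvw)]
        obtain ⟨x, hx⟩ : ((S.erase r).erase v).Nonempty := Finset.card_pos.1 (by
          rw [Finset.card_erase_of_mem hvT, Finset.card_erase_of_mem hw]; omega)
        exact (angle_nonneg _ _ _).trans (hwr x hx)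
      · exact hwr r hr'
    · rcases hcases r hr with rfl | hr'
      · rw [angle_comm]; exact hwr p hp'
      · exact (hA v hvT p hp' r hr').trans hAB

/-- This makes the angular coordinate at a hull vertex `v` available for every point of the
configuration, not just for hull vertices. -/
lemma mem_cone_of_mem_convexHull_insert {v p : ℍ} {T : Finset ℍ} (hT : T.Nonempty)
    (h : klein p ∈ convexHull ℝ (insert (klein v) (klein '' T))) (hpv : p ≠ v) :
    p ∈ cone v T := by
  rw [convexHull_insert ((Finset.coe_nonempty.2 hT).image _), mem_convexJoin] at h
  obtain ⟨a, ha, y, hy, hseg⟩ := h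
  rw [Set.mem_singleton_iff.1 ha, segment_eq_image'] at hseg
  obtain ⟨c, ⟨hc, -⟩, e⟩ := hseg
  simp only at e
  refine ⟨c, lt_of_le_of_ne hc ?_, y, hy, by rw [← e]; simp⟩
  rintro rfl
  rw [zero_smul, add_zero] at e
  exact hpv (klein_injective e.symm)

open Classical in
/-- Among `n ≥ 3` points of the hyperbolic plane there are three with an angle below `π / n`. -/
lemma exists_angle_lt {n : ℕ} (hn : 3 ≤ n) (C : Finset ℍ) (hC : C.card = n) :
    ∃ p ∈ C, ∃ q ∈ C, ∃ r ∈ C, p ≠ q ∧ r ≠ q ∧ p ≠ r ∧ angle p q r < Real.pi / n := by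
  by_contra! hcon
  obtain ⟨H, hHC, hconv, hsub⟩ := exists_convexPosition C
  have hH2 : 2 ≤ H.card := by
    by_contra hlt
    have hsubs : (H : Set ℍ).Subsingleton := by
      intro x hx y hy
      exact Finset.card_le_one.1 (by omega) x hx y hy
    have hss : (convexHull ℝ (klein '' (H : Set ℍ))).Subsingleton := by
      rcases (hsubs.image klein).eq_empty_or_singleton with e | ⟨y, e⟩ <;> rw [e] <;> simp
    obtain ⟨x, hx, y, hy, hxy⟩ := Finset.one_lt_card.1 (by omega : 1 < C.card)
    exact hxy (klein_injective (hss (hsub ⟨x, hx, rfl⟩) (hsub ⟨y, hy, rfl⟩)))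
  obtain ⟨k, hk⟩ : ∃ k, H.card = k + 2 := ⟨H.card - 2, by omega⟩
  obtain ⟨A, hA, hle, hlt⟩ := exists_angle_bound k H hconv hk
  have hnpos : (0 : ℝ) < n := by exact_mod_cast (by omega : 0 < n)
  -- The `n - 1` points other than `v` have angular coordinates at mutual distance at least `π / n`,
  -- hence leave `n - 2` gaps of that size.
  have hlow : ∀ v ∈ H, ((n : ℝ) - 2) * (Real.pi / n) ≤ A v := by
    intro v hv
    obtain ⟨t, -, hang, hbet, -⟩ := exists_angular_coordinate (hconv v hv)
    have hT : (H.erase v).Nonempty := Finset.card_pos.1 (by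
      rw [Finset.card_erase_of_mem hv]; omega)
    have hmem : ∀ p ∈ C.erase v, p ∈ cone v (H.erase v) := by
      intro p hp
      rw [Finset.mem_erase] at hp
      refine mem_cone_of_mem_convexHull_insert hT ?_ hp.1
      rw [← Set.image_insert_eq, ← Finset.coe_insert, Finset.insert_erase hv]
      exact hsub ⟨p, hp.2, rfl⟩
    obtain ⟨m, hm⟩ : ∃ m, n = m + 2 := ⟨n - 2, by omega⟩
    obtain ⟨p, hp, r, hr, hpr⟩ := exists_sub_ge_of_separated t (Real.pi / n) m (C.erase v)
      (by rw [Finset.card_erase_of_mem (hHC hv)]; omega) (by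
        intro p hp r hr hpr
        rw [← hang p (hmem p hp) r (hmem r hr)]
        exact hcon p (Finset.mem_of_mem_erase hp) v (hHC hv) r (Finset.mem_of_mem_erase hr)
          (Finset.ne_of_mem_erase hp) (Finset.ne_of_mem_erase hr) hpr)
    obtain ⟨-, y, hy, hyt⟩ := hbet p (hmem p hp)
    obtain ⟨⟨z, hz, hzt⟩, -⟩ := hbet r (hmem r hr)
    have h1 := hA v hv y hy z hz
    rw [hang y (mem_cone_of_mem hy) z (mem_cone_of_mem hz)] at h1
    have h2 := le_abs_self (t y - t z)
    have h3 : (n : ℝ) - 2 = m := by rw [hm]; push_cast; ring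
    rw [h3]
    linarith
  have hsum := Finset.card_nsmul_le_sum H A _ hlow
  rw [hk, nsmul_eq_mul] at hsum
  have hkn : k + 2 ≤ n := by rw [← hk, ← hC]; exact Finset.card_le_card hHC
  have hkn' : (k : ℝ) + 2 ≤ n := by exact_mod_cast hkn
  have hn3 : (3 : ℝ) ≤ n := by exact_mod_cast hn
  have e : ((k + 2 : ℕ) : ℝ) * (((n : ℝ) - 2) * (Real.pi / n))
      = k * Real.pi + 2 * (n - (k + 2)) * (Real.pi / n) := by
    push_cast; field_simp; ring
  have hpn : 0 < Real.pi / n := div_pos Real.pi_pos hnpos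
  rw [e] at hsum
  rcases Nat.eq_zero_or_pos k with rfl | hk0
  · have : 0 < 2 * ((n : ℝ) - ((0 : ℕ) + 2)) * (Real.pi / n) := by
      apply mul_pos _ hpn
      push_cast; linarith
    exact (lt_add_of_pos_right _ this).not_ge (hsum.trans hle)
  · have : 0 ≤ 2 * ((n : ℝ) - (k + 2)) * (Real.pi / n) := by
      apply mul_nonneg _ hpn.le
      linarith
    linarith [hlt hk0]

/-! ### Area of a hyperbolic disk -/

/-- A hyperbolic disk of radius `ρ` about a point of height `y` is a Euclidean disk with centre at
height `h = y cosh ρ` and radius `R = y sinh ρ`. The integrand is half the width of its slice at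
height `s`, weighted by `1 / s²`. -/
lemma hasDerivAt_area_primitive {y h R s : ℝ} (hy : 0 < y) (hR : 0 < R) (e : h ^ 2 = R ^ 2 + y ^ 2)
    (hs0 : 0 < s) (hQ : 0 < R ^ 2 - (s - h) ^ 2) :
    HasDerivAt (fun s => -(√(R ^ 2 - (s - h) ^ 2) / s) - Real.arcsin ((s - h) / R)
      + h / y * Real.arcsin ((h * s - y ^ 2) / (R * s)))
      (√(R ^ 2 - (s - h) ^ 2) / s ^ 2) s := by
  obtain ⟨w, hw⟩ : ∃ w, w = √(R ^ 2 - (s - h) ^ 2) := ⟨_, rfl⟩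
  have hw0 : 0 < w := hw ▸ Real.sqrt_pos.2 hQ
  have hw2 : w ^ 2 = R ^ 2 - (s - h) ^ 2 := hw ▸ Real.sq_sqrt hQ.le
  have dsub : HasDerivAt (fun s : ℝ => s - h) 1 s := (hasDerivAt_id s).sub_const h
  have d1 : HasDerivAt (fun s => √(R ^ 2 - (s - h) ^ 2)) (-(s - h) / w) s := by
    have := ((dsub.pow 2).const_sub (R ^ 2)).sqrt hQ.ne'
    convert! this using 1
    simp only [Pi.pow_apply, ← hw]
    field_simp
    simp [mul_comm]
  have d1' := (d1.fun_div (hasDerivAt_id s) hs0.ne').fun_neg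
  have a2 : 1 - ((s - h) / R) ^ 2 = (w / R) ^ 2 := by
    rw [div_pow, div_pow, hw2]; field_simp
  have a3 : 1 - ((h * s - y ^ 2) / (R * s)) ^ 2 = (y * w / (R * s)) ^ 2 := by
    rw [div_pow, div_pow, mul_pow y, hw2]; field_simp
    linear_combination (-(s ^ 2) + y ^ 2) * e
  have ne : ∀ {a b : ℝ}, 0 < b → 1 - a ^ 2 = b ^ 2 → a ≠ -1 ∧ a ≠ 1 := by
    intro a b hb hab
    constructor <;> rintro rfl <;> norm_num at hab <;> exact pow_ne_zero 2 hb.ne' hab.symm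
  have p2 : 0 < w / R := by positivity
  have p3 : 0 < y * w / (R * s) := by positivity
  have d2 := (Real.hasDerivAt_arcsin (ne p2 a2).1 (ne p2 a2).2).comp s (dsub.div_const R)
  have dq : HasDerivAt (fun s => (h * s - y ^ 2) / (R * s))
      ((h * 1 * (R * s) - (h * s - y ^ 2) * (R * 1)) / (R * s) ^ 2) s :=
    (((hasDerivAt_id s).const_mul h).sub_const (y ^ 2)).fun_div ((hasDerivAt_id s).const_mul R)
      (by positivity)
  have d3 := ((Real.hasDerivAt_arcsin (ne p3 a3).1 (ne p3 a3).2).comp s dq).const_mul (h / y)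
  rw [a2, Real.sqrt_sq p2.le] at d2
  rw [a3, Real.sqrt_sq p3.le] at d3
  convert! (d1'.fun_sub d2).fun_add d3 using 1
  rw [← hw]
  simp only [id]
  field_simp
  ring

lemma integral_area {y h R : ℝ} (hy : 0 < y) (hR : 0 < R) (hh : 0 < h)
    (e : h ^ 2 = R ^ 2 + y ^ 2) :
    IntervalIntegrable (fun s => √(R ^ 2 - (s - h) ^ 2) / s ^ 2) MeasureTheory.volume
      (h - R) (h + R) ∧
    ∫ s in (h - R)..(h + R), √(R ^ 2 - (s - h) ^ 2) / s ^ 2 = Real.pi * (h / y - 1) := by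
  have hRh : R < h := by nlinarith
  have hle : h - R ≤ h + R := by linarith
  have hne : ∀ s ∈ Set.Icc (h - R) (h + R), s ≠ 0 := fun s hs => by
    have := hs.1; intro h0; linarith
  have hc1 : ContinuousOn (fun s => √(R ^ 2 - (s - h) ^ 2) / s ^ 2) (Set.Icc (h - R) (h + R)) := by
    refine ContinuousOn.div (by fun_prop) (by fun_prop) fun s hs => pow_ne_zero _ (hne s hs)
  have hint := hc1.intervalIntegrable_of_Icc (μ := MeasureTheory.volume) hle
  refine ⟨hint, ?_⟩
  rw [intervalIntegral.integral_eq_sub_of_hasDerivAt_of_le hle ?_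
    (fun s hs => hasDerivAt_area_primitive hy hR e ?_ ?_) hint]
  -- At the end points the root vanishes and both arcsines run from `-π/2` to `π/2`, leaving `-π + π
  -- h / y`.
  · have z1 : R ^ 2 - (h + R - h) ^ 2 = 0 := by ring
    have z2 : R ^ 2 - (h - R - h) ^ 2 = 0 := by ring
    have z3 : (h + R - h) / R = 1 := by field_simp; ring
    have z4 : (h - R - h) / R = -1 := by field_simp; ring
    have n5 : h + R ≠ 0 := by linarith
    have n6 : h - R ≠ 0 := by linarith
    have z5 : (h * (h + R) - y ^ 2) / (R * (h + R)) = 1 := by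
      field_simp; linear_combination e
    have z6 : (h * (h - R) - y ^ 2) / (R * (h - R)) = -1 := by
      field_simp; linear_combination e
    rw [z1, z2, z3, z4, z5, z6, Real.sqrt_zero, Real.arcsin_one, Real.arcsin_neg_one]
    ring
  · refine ContinuousOn.add (ContinuousOn.sub (ContinuousOn.neg ?_) ?_) ?_
    · exact ContinuousOn.div (by fun_prop) (by fun_prop) hne
    · exact Real.continuous_arcsin.comp_continuousOn (by fun_prop)
    · refine continuousOn_const.mul (Real.continuous_arcsin.comp_continuousOn ?_)
      exact ContinuousOn.div (by fun_prop) (by fun_prop) fun s hs => mul_ne_zero hR.ne' (hne s hs)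
  · linarith [hs.1]
  · nlinarith [hs.1, hs.2]

lemma volume_slice (a h R s : ℝ) :
    MeasureTheory.volume {x : ℝ | (x - a) ^ 2 + (s - h) ^ 2 ≤ R ^ 2}
      = ENNReal.ofReal (2 * √(R ^ 2 - (s - h) ^ 2)) := by
  rcases le_or_gt 0 (R ^ 2 - (s - h) ^ 2) with hQ | hQ
  · have : {x : ℝ | (x - a) ^ 2 + (s - h) ^ 2 ≤ R ^ 2}
        = Set.Icc (a - √(R ^ 2 - (s - h) ^ 2)) (a + √(R ^ 2 - (s - h) ^ 2)) := by
      ext x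
      rw [Set.mem_ofPred_eq, ← le_sub_iff_add_le, Real.sq_le hQ, Set.mem_Icc]
      constructor <;> rintro ⟨h1, h2⟩ <;> constructor <;> linarith
    rw [this, Real.volume_Icc]
    congr 1; ring
  · rw [Real.sqrt_eq_zero_of_nonpos hQ.le]
    have : {x : ℝ | (x - a) ^ 2 + (s - h) ^ 2 ≤ R ^ 2} = ∅ := by
      ext x
      simp only [Set.mem_ofPred_eq, Set.mem_empty_iff_false, iff_false, not_le]
      nlinarith [sq_nonneg (x - a)]
    rw [this]; simp

-- Fubini over horizontal slices, for a weight depending on the height only.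
open MeasureTheory in
lemma lintegral_closedBall_eq (a h R : ℝ) (hR : 0 ≤ R) (f : ℝ → ENNReal) (hf : Measurable f) :
    ∫⁻ z in Metric.closedBall (⟨a, h⟩ : ℂ) R, f z.im
      = ∫⁻ s in Set.Icc (h - R) (h + R), ENNReal.ofReal (2 * √(R ^ 2 - (s - h) ^ 2)) * f s := by
  have hset : (Complex.measurableEquivRealProd.symm) ⁻¹' (Metric.closedBall (⟨a, h⟩ : ℂ) R)
      = {p : ℝ × ℝ | (p.1 - a) ^ 2 + (p.2 - h) ^ 2 ≤ R ^ 2} := by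
    ext p
    rw [Set.mem_preimage, Metric.mem_closedBall, Complex.dist_eq_re_im,
      Real.sqrt_le_left hR]
    rfl
  have hmeas : MeasurableSet {p : ℝ × ℝ | (p.1 - a) ^ 2 + (p.2 - h) ^ 2 ≤ R ^ 2} :=
    measurableSet_le (by fun_prop) (by fun_prop)
  rw [← (Complex.volume_preserving_equiv_real_prod.symm).setLIntegral_comp_preimage_emb
    Complex.measurableEquivRealProd.symm.measurableEmbedding, hset,
    ← lintegral_indicator hmeas, Measure.volume_eq_prod, lintegral_prod_symm]
  swap
  · exact ((hf.comp (Complex.measurable_im.comp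
      Complex.measurableEquivRealProd.symm.measurable)).indicator hmeas).aemeasurable
  rw [← lintegral_indicator measurableSet_Icc]
  congr 1
  ext s
  have : (fun x : ℝ => {p : ℝ × ℝ | (p.1 - a) ^ 2 + (p.2 - h) ^ 2 ≤ R ^ 2}.indicator
      (fun p => f (Complex.measurableEquivRealProd.symm p).im) (x, s))
      = {x : ℝ | (x - a) ^ 2 + (s - h) ^ 2 ≤ R ^ 2}.indicator fun _ => f s := rfl
  rw [this, lintegral_indicator_const (measurableSet_le (by fun_prop) (by fun_prop)),
    volume_slice, mul_comm]
  by_cases hs : s ∈ Set.Icc (h - R) (h + R)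
  · rw [Set.indicator_of_mem hs]
  · rw [Set.indicator_of_notMem hs, Real.sqrt_eq_zero_of_nonpos]
    · simp
    · rw [Set.mem_Icc, not_and_or, not_le, not_le] at hs
      rcases hs with hs | hs <;> nlinarith

open MeasureTheory in
/-- The area of a hyperbolic disk of radius `ρ`. -/
lemma volume_closedBall (c : ℍ) {ρ : ℝ} (hρ : 0 < ρ) :
    volume (Metric.closedBall c ρ) = ENNReal.ofReal (2 * Real.pi * (Real.cosh ρ - 1)) := by
  have hy := c.im_pos
  have hsinh := Real.sinh_pos_iff.2 hρ
  have hR : 0 < c.im * Real.sinh ρ := mul_pos hy hsinh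
  have hh : 0 < c.im * Real.cosh ρ := mul_pos hy (Real.cosh_pos ρ)
  have e : (c.im * Real.cosh ρ) ^ 2 = (c.im * Real.sinh ρ) ^ 2 + c.im ^ 2 := by
    rw [mul_pow, mul_pow, Real.cosh_sq]; ring
  have hcen : ((c.center ρ : ℍ) : ℂ) = ⟨c.re, c.im * Real.cosh ρ⟩ := rfl
  obtain ⟨hint, hval⟩ := integral_area hy hR hh e
  have hle : c.im * Real.cosh ρ - c.im * Real.sinh ρ ≤ c.im * Real.cosh ρ + c.im * Real.sinh ρ := by
    linarith
  rw [UpperHalfPlane.volume_eq_lintegral, UpperHalfPlane.image_coe_closedBall, hcen]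
  have hf : Measurable fun s : ℝ => (((1 / ‖s‖₊) ^ 2 : NNReal) : ENNReal) := by fun_prop
  rw [lintegral_closedBall_eq _ _ _ hR.le _ hf]
  have : ∀ s : ℝ, ENNReal.ofReal
      (2 * √((c.im * Real.sinh ρ) ^ 2 - (s - c.im * Real.cosh ρ) ^ 2))
        * (((1 / ‖s‖₊) ^ 2 : NNReal) : ENNReal)
      = ENNReal.ofReal (2 * (√((c.im * Real.sinh ρ) ^ 2 - (s - c.im * Real.cosh ρ) ^ 2) / s ^ 2)) := by
    intro s
    have : (((1 / ‖s‖₊) ^ 2 : NNReal) : ENNReal) = ENNReal.ofReal (1 / s ^ 2) := by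
      rw [← ENNReal.ofReal_coe_nnreal]
      push_cast
      rw [div_pow, one_pow, Real.norm_eq_abs, sq_abs]
    rw [this, ← ENNReal.ofReal_mul (by positivity)]
    congr 1; ring
  simp_rw [this]
  rw [← ofReal_integral_eq_lintegral_ofReal, integral_const_mul, integral_Icc_eq_integral_Ioc,
    ← intervalIntegral.integral_of_le hle, hval]
  · congr 1
    field_simp
  · apply (integrableOn_Icc_iff_integrableOn_Ioc (by simp)).2
    exact ((intervalIntegrable_iff_integrableOn_Ioc_of_le hle).1 hint).const_mul 2
  · exact Filter.Eventually.of_forall fun s => by positivity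

/-! ### Change of centre and inscribed angles -/

lemma norm_toDisk (q w : ℍ) : ‖(toDisk q w : ℂ)‖ = Real.tanh (dist w q / 2) := by
  rw [UpperHalfPlane.tanh_half_dist, coe_toDisk, norm_div, Complex.dist_eq, Complex.dist_eq]

lemma dist_eq_of_norm_toDisk_eq {q z w : ℍ} (h : ‖(toDisk q z : ℂ)‖ = ‖(toDisk q w : ℂ)‖) :
    dist z q = dist w q := by
  rw [norm_toDisk, norm_toDisk, Real.tanh_eq_sinh_div_cosh, Real.tanh_eq_sinh_div_cosh,
    div_eq_div_iff (Real.cosh_pos _).ne' (Real.cosh_pos _).ne'] at h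
  have h1 : Real.sinh (dist z q / 2 - dist w q / 2) = 0 := by
    rw [Real.sinh_sub]; linarith
  rw [Real.sinh_eq_zero] at h1
  linarith

lemma coe_toDisk_rotation (c p : ℍ) (θ : ℝ) :
    (toDisk c (rotation c θ p) : ℂ) = Complex.exp (θ * Complex.I) * toDisk c p := by
  rw [rotation, Equiv.apply_symm_apply, Complex.UnitDisc.coe_circle_smul, Circle.coe_exp]

lemma dist_rotation (c p : ℍ) (θ : ℝ) : dist (rotation c θ p) c = dist p c := by
  apply dist_eq_of_norm_toDisk_eq
  rw [coe_toDisk_rotation, norm_mul, Complex.norm_exp_ofReal_mul_I, one_mul]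

/-- Change of the centre of the Poincaré disk. -/
lemma toDisk_eq_moebius (c q z : ℍ) :
    (toDisk q z : ℂ) = ((1 - conj (toDisk c q : ℂ)) / (1 - toDisk c q)) *
      ((toDisk c z - toDisk c q) / (1 - conj (toDisk c q : ℂ) * toDisk c z)) := by
  obtain ⟨w, rfl⟩ := (toDisk c).symm.surjective z
  obtain ⟨v, rfl⟩ := (toDisk c).symm.surjective q
  simp only [Equiv.apply_symm_apply]
  have e : ∀ u : 𝔻, (((toDisk c).symm u : ℍ) : ℂ) = ((c : ℂ) - conj (c : ℂ) * u) / (1 - u) :=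
    fun _ => rfl
  have hne : ∀ u : 𝔻, (1 - (u : ℂ)) ≠ 0 := fun u => sub_ne_zero.2 u.coe_ne_one.symm
  have hc := sub_conj_ne_zero c c
  have hw := hne w
  have hv := hne v
  have hv' : 1 - conj (v : ℂ) ≠ 0 := by
    have := (map_ne_zero (starRingEnd ℂ)).2 hv
    rwa [map_sub, map_one] at this
  have hvw : 1 - conj (v : ℂ) * w ≠ 0 := by
    intro h
    have h1 : ‖conj (v : ℂ) * w‖ < 1 := by
      rw [norm_mul, RCLike.norm_conj]
      exact mul_lt_one_of_nonneg_of_lt_one_left (norm_nonneg _) v.norm_lt_one w.norm_lt_one.le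
    rw [← sub_eq_zero.1 h] at h1
    simp at h1
  have n1 : ((c : ℂ) - conj (c : ℂ) * w) / (1 - w) - ((c : ℂ) - conj (c : ℂ) * v) / (1 - v)
      = ((c : ℂ) - conj (c : ℂ)) * (w - v) / ((1 - w) * (1 - v)) := by
    field_simp; ring
  have n2 : ((c : ℂ) - conj (c : ℂ) * w) / (1 - w)
      - (conj (c : ℂ) - c * conj (v : ℂ)) / (1 - conj (v : ℂ))
      = ((c : ℂ) - conj (c : ℂ)) * (1 - conj (v : ℂ) * w) / ((1 - w) * (1 - conj (v : ℂ))) := by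
    field_simp; ring
  rw [coe_toDisk, e, e, n1]
  simp only [map_div₀, map_sub, map_mul, map_one, Complex.conj_conj]
  rw [n2]
  field_simp

/-- The sine of the argument is at most `‖w‖`, and Jordan's inequality `2x/π ≤ sin x` supplies the
constant `π / 2`. -/
lemma abs_arg_one_sub_le {w : ℂ} (hw : ‖w‖ < 1) : |(1 - w).arg| ≤ Real.pi / 2 * ‖w‖ := by
  have hre : 0 < (1 - w).re := by
    have := Complex.re_le_norm w
    simp; linarith
  have h1 := abs_arg_lt_of_re_pos hre
  have hn : 0 < ‖1 - w‖ := norm_pos_iff.2 (ne_zero_of_re_pos hre)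
  have h2 := Real.mul_le_sin (abs_nonneg (1 - w).arg) h1.le
  have h3 : Real.sin |(1 - w).arg| ≤ ‖w‖ := by
    have : Real.sin |(1 - w).arg| ≤ |Real.sin (1 - w).arg| := by
      rcases abs_cases (1 - w).arg with ⟨e, -⟩ | ⟨e, -⟩ <;> rw [e]
      · exact le_abs_self _
      · rw [Real.sin_neg]; exact neg_le_abs _
    refine this.trans ?_
    rw [Complex.sin_arg, abs_div, abs_of_pos hn, div_le_iff₀ hn]
    refine abs_le_of_sq_le_sq ?_ (by positivity)
    rw [mul_pow, Complex.sq_norm, Complex.sq_norm, Complex.normSq_apply, Complex.normSq_apply]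
    simp only [Complex.sub_re, Complex.sub_im, Complex.one_re, Complex.one_im]
    -- The difference of the two sides is exactly the square `(|w|² - Re w)²`.
    nlinarith [sq_nonneg (w.re * w.re + w.im * w.im - w.re)]
  have hpi := Real.pi_pos
  calc |(1 - w).arg| = Real.pi / 2 * (2 / Real.pi * |(1 - w).arg|) := by field_simp
    _ ≤ Real.pi / 2 * ‖w‖ := by gcongr; linarith

lemma angle_div_one_sub_le {z w : ℂ} (hz : z ≠ 0) (hw : ‖w‖ < 1) :
    InnerProductGeometry.angle (z / (1 - w)) z ≤ Real.pi / 2 * ‖w‖ := by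
  have h1 : 1 - w ≠ 0 := by
    intro h
    rw [← sub_eq_zero.1 h] at hw
    simp at hw
  rw [Complex.angle_div_left_eq_angle_mul_right]
  nth_rw 1 [← mul_one z]
  rw [Complex.angle_mul_left hz, Complex.angle_one_left h1]
  exact abs_arg_one_sub_le hw

lemma exp_sub_one_eq (φ : ℝ) : Complex.exp (φ * Complex.I) - 1
    = (2 * Real.sin (φ / 2)) • (Complex.I * Complex.exp ((φ / 2 : ℝ) * Complex.I)) := by
  have : Complex.exp (φ * Complex.I)
      = Complex.exp ((φ / 2 : ℝ) * Complex.I) * Complex.exp ((φ / 2 : ℝ) * Complex.I) := by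
    rw [← Complex.exp_add]; congr 1; push_cast; ring
  have h2 := Complex.cos_sq_add_sin_sq ((φ / 2 : ℝ) : ℂ)
  rw [this, Complex.exp_mul_I, Complex.real_smul]
  push_cast at *
  linear_combination h2 - Complex.sin (φ / 2) ^ 2 * Complex.I_sq

/-- The inscribed angle theorem at the point `1` of the unit circle: the chord to `exp (iφ)` is a
positive multiple of `i exp (iφ/2)`. -/
lemma angle_exp_sub_one {φ ψ : ℝ} (h1 : 0 < φ) (h2 : φ < 2 * Real.pi) (h3 : 0 < ψ)
    (h4 : ψ < 2 * Real.pi) :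
    InnerProductGeometry.angle (Complex.exp (φ * Complex.I) - 1) (Complex.exp (ψ * Complex.I) - 1)
      = |φ - ψ| / 2 := by
  have s1 : 0 < 2 * Real.sin (φ / 2) :=
    mul_pos two_pos (Real.sin_pos_of_pos_of_lt_pi (by linarith) (by linarith))
  have s2 : 0 < 2 * Real.sin (ψ / 2) :=
    mul_pos two_pos (Real.sin_pos_of_pos_of_lt_pi (by linarith) (by linarith))
  rw [exp_sub_one_eq, exp_sub_one_eq, InnerProductGeometry.angle_smul_left_of_pos _ _ s1,
    InnerProductGeometry.angle_smul_right_of_pos _ _ s2, Complex.angle_mul_left Complex.I_ne_zero,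
    Complex.angle_exp_exp, (toIocMod_eq_self _).2 (by constructor <;> linarith),
    ← sub_div, abs_div, abs_two]

/-- The angle at a point `q` of a circle with centre `c` is nearly the Euclidean inscribed angle. -/
lemma inscribed_angle_ge {c p q r : ℍ} {φ ψ : ℝ} (hq : q ≠ c)
    (hp : (toDisk c p : ℂ) = Complex.exp (φ * Complex.I) * toDisk c q)
    (hr : (toDisk c r : ℂ) = Complex.exp (ψ * Complex.I) * toDisk c q)
    (h1 : 0 < φ) (h2 : φ < 2 * Real.pi) (h3 : 0 < ψ) (h4 : ψ < 2 * Real.pi) :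
    |φ - ψ| / 2 - Real.pi * Real.tanh (dist q c / 2) ^ 2 ≤ angle p q r := by
  obtain ⟨v, hv⟩ : ∃ v, v = toDisk c q := ⟨_, rfl⟩
  have hn : ‖(v : ℂ)‖ = Real.tanh (dist q c / 2) := by rw [hv, norm_toDisk]
  have hv0 : (v : ℂ) ≠ 0 := by
    rw [← norm_pos_iff, hn, Real.tanh_eq_sinh_div_cosh]
    exact div_pos (Real.sinh_pos_iff.2 (half_pos (dist_pos.2 hq))) (Real.cosh_pos _)
  have hone : (1 - (v : ℂ)) ≠ 0 := sub_ne_zero.2 v.coe_ne_one.symm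
  have hone' : 1 - conj (v : ℂ) ≠ 0 := by
    have := (map_ne_zero (starRingEnd ℂ)).2 hone
    rwa [map_sub, map_one] at this
  -- Seen from `q`, every point of the circle carries the same complex factor, irrelevant for
  -- angles, and a Euclidean chord divided by `1 - |v|² exp (iθ)`. That denominator turns each side
  -- by at most `(π/2) |v|²`.
  have key : ∀ (x : ℍ) (θ : ℝ), (toDisk c x : ℂ) = Complex.exp (θ * Complex.I) * v →
      (toDisk q x : ℂ) = ((1 - conj (v : ℂ)) / (1 - v) * v) *
        ((Complex.exp (θ * Complex.I) - 1)
          / (1 - ((‖(v : ℂ)‖ ^ 2 : ℝ) : ℂ) * Complex.exp (θ * Complex.I))) := by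
    intro x θ hx
    rw [toDisk_eq_moebius c q x, ← hv, hx]
    push_cast
    rw [← Complex.conj_mul']
    ring
  have hsmall : ∀ θ : ℝ, ‖((‖(v : ℂ)‖ ^ 2 : ℝ) : ℂ) * Complex.exp (θ * Complex.I)‖
      = Real.tanh (dist q c / 2) ^ 2 := by
    intro θ
    rw [norm_mul, Complex.norm_exp_ofReal_mul_I, mul_one, Complex.norm_real, hn,
      Real.norm_of_nonneg (sq_nonneg _)]
  have hlt : Real.tanh (dist q c / 2) ^ 2 < 1 := by
    rw [← hn]
    exact pow_lt_one₀ (norm_nonneg _) v.norm_lt_one two_ne_zero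
  have hE : ∀ θ : ℝ, 0 < θ → θ < 2 * Real.pi → Complex.exp (θ * Complex.I) - 1 ≠ 0 := by
    intro θ hθ hθ'
    rw [exp_sub_one_eq]
    refine smul_ne_zero ?_ (mul_ne_zero Complex.I_ne_zero (Complex.exp_ne_zero _))
    exact (mul_pos two_pos (Real.sin_pos_of_pos_of_lt_pi (by linarith) (by linarith))).ne'
  rw [← hv] at hp hr
  rw [angle, key p φ hp, key r ψ hr,
    Complex.angle_mul_left (mul_ne_zero (div_ne_zero hone' hone) hv0)]
  have a1 := angle_div_one_sub_le (hE φ h1 h2) ((hsmall φ).trans_lt hlt)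
  have a2 := angle_div_one_sub_le (hE ψ h3 h4) ((hsmall ψ).trans_lt hlt)
  rw [hsmall] at a1 a2
  have a3 := angle_exp_sub_one h1 h2 h3 h4
  set x := Complex.exp (φ * Complex.I) - 1
  set y := Complex.exp (ψ * Complex.I) - 1
  set x' := x / (1 - ((‖(v : ℂ)‖ ^ 2 : ℝ) : ℂ) * Complex.exp (φ * Complex.I))
  set y' := y / (1 - ((‖(v : ℂ)‖ ^ 2 : ℝ) : ℂ) * Complex.exp (ψ * Complex.I))
  have t1 := InnerProductGeometry.angle_le_angle_add_angle x x' y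
  have t2 := InnerProductGeometry.angle_le_angle_add_angle x' y' y
  rw [InnerProductGeometry.angle_comm x x'] at t1
  linarith

/-! ### Regular polygons -/

/-- Differences of vertices of a regular `n`-gon, counted counterclockwise. -/
lemma exists_exp_eq_mul {n a b : ℕ} (ha : a < n) (hb : b < n) (hab : a ≠ b) :
    ∃ m : ℕ, 0 < m ∧ m < n ∧ (m + b = a ∨ m + b = a + n) ∧
      Complex.exp ((2 * Real.pi * (a : ℝ) / n : ℝ) * Complex.I)
        = Complex.exp ((2 * Real.pi * (m : ℝ) / n : ℝ) * Complex.I)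
          * Complex.exp ((2 * Real.pi * (b : ℝ) / n : ℝ) * Complex.I) := by
  have hn : (n : ℂ) ≠ 0 := by exact_mod_cast (by omega : n ≠ 0)
  rcases lt_or_gt_of_ne hab with h | h
  · refine ⟨a + n - b, by omega, by omega, by omega, ?_⟩
    rw [← Complex.exp_add, Nat.cast_sub (by omega)]
    have : ((2 * Real.pi * (((a + n : ℕ) : ℝ) - b) / n : ℝ) : ℂ) * Complex.I
        + ((2 * Real.pi * (b : ℝ) / n : ℝ) : ℂ) * Complex.I
        = ((2 * Real.pi * (a : ℝ) / n : ℝ) : ℂ) * Complex.I + 2 * Real.pi * Complex.I := by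
      push_cast; field_simp; ring
    rw [this, Complex.exp_add, Complex.exp_two_pi_mul_I, mul_one]
  · refine ⟨a - b, by omega, by omega, by omega, ?_⟩
    rw [← Complex.exp_add, Nat.cast_sub (by omega)]
    congr 1
    push_cast; field_simp; ring

section RegularPolygon

variable {n : ℕ} {c p : ℍ}

lemma rotation_ne_rotation (hp : p ≠ c) {a b : ℕ} (ha : a < n) (hb : b < n) (hab : a ≠ b) :
    rotation c (2 * Real.pi * (a : ℝ) / n) p ≠ rotation c (2 * Real.pi * (b : ℝ) / n) p := by
  intro h
  have h1 := congrArg (fun z => (toDisk c z : ℂ)) h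
  simp only [coe_toDisk_rotation] at h1
  have hp0 : (toDisk c p : ℂ) ≠ 0 := by
    rw [coe_toDisk]
    refine div_ne_zero (sub_ne_zero.2 fun e => hp (UpperHalfPlane.ext e)) (sub_conj_ne_zero c p)
  have h2 := mul_right_cancel₀ hp0 h1
  obtain ⟨m, hm0, hmn, -, e⟩ := exists_exp_eq_mul ha hb hab
  rw [h2, eq_comm, mul_eq_right₀ (Complex.exp_ne_zero _), Complex.exp_eq_one_iff] at e
  obtain ⟨k, hk⟩ := e
  have hn0 : (n : ℂ) ≠ 0 := by exact_mod_cast (by omega : n ≠ 0)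
  have hpi : (Real.pi : ℂ) ≠ 0 := by exact_mod_cast Real.pi_ne_zero
  push_cast at hk
  field_simp at hk
  have hk' : (m : ℤ) = n * k := by exact_mod_cast hk
  have : (n : ℤ) ∣ m := ⟨k, hk'⟩
  have := Nat.le_of_dvd hm0 (Int.natCast_dvd_natCast.1 this)
  omega

lemma regularPolygon_mem_configurations (hp : p ≠ c) :
    regularPolygon n c p ∈ configurations n := by
  have hinj : Function.Injective fun k : Fin n => rotation c (2 * Real.pi * ((k : ℕ) : ℝ) / n) p := by
    intro a b hab
    by_contra hne
    exact rotation_ne_rotation hp a.2 b.2 (fun e => hne (Fin.ext e)) hab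
  change (Set.range _).encard = n
  rw [← Set.image_univ, hinj.encard_image, Set.encard_univ, ENat.card_eq_coe_fintype_card,
    Fintype.card_fin]

lemma regularPolygon_subset_sphere (n : ℕ) (c p : ℍ) :
    regularPolygon n c p ⊆ Metric.sphere c (dist p c) := by
  rintro _ ⟨k, rfl⟩
  exact dist_rotation c p _

lemma angle_regularPolygon_ge (hp : p ≠ c) {θ : ℝ} (hθ : θ ∈ angles (regularPolygon n c p)) :
    Real.pi / n - Real.pi * Real.tanh (dist p c / 2) ^ 2 ≤ θ := by
  obtain ⟨_, ⟨i, rfl⟩, _, ⟨j, rfl⟩, _, ⟨k, rfl⟩, hij, hkj, hik, rfl⟩ := hθ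
  have hpi := Real.pi_pos
  have hn : (0 : ℝ) < n := by exact_mod_cast i.pos
  have ne : ∀ {x y : Fin n}, rotation c (2 * Real.pi * ((x : ℕ) : ℝ) / n) p
      ≠ rotation c (2 * Real.pi * ((y : ℕ) : ℝ) / n) p → (x : ℕ) ≠ y := by
    intro x y h e
    exact h (by rw [e])
  obtain ⟨m, hm0, hmn, hm, em⟩ := exists_exp_eq_mul i.2 j.2 (ne hij)
  obtain ⟨l, hl0, hln, hl, el⟩ := exists_exp_eq_mul k.2 j.2 (ne hkj)
  have hik' := ne hik
  -- `m - l` is congruent to `i - k` modulo `n`, so the inscribed angle `|m - l| π / n` is at least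
  -- `π / n`.
  have hml : m ≠ l := by omega
  have bounds : ∀ x : ℕ, 0 < x → x < n → 0 < 2 * Real.pi * (x : ℝ) / n ∧
      2 * Real.pi * (x : ℝ) / n < 2 * Real.pi := by
    intro x h0 h1
    have h0' : (0 : ℝ) < x := by exact_mod_cast h0
    have h1' : (x : ℝ) < n := by exact_mod_cast h1
    refine ⟨by positivity, ?_⟩
    rw [div_lt_iff₀ hn]
    gcongr
  have hq : rotation c (2 * Real.pi * ((j : ℕ) : ℝ) / n) p ≠ c := by
    rw [← dist_pos, dist_rotation]; exact dist_pos.2 hp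
  have := inscribed_angle_ge (p := rotation c (2 * Real.pi * ((i : ℕ) : ℝ) / n) p)
    (r := rotation c (2 * Real.pi * ((k : ℕ) : ℝ) / n) p) hq
    (by rw [coe_toDisk_rotation, coe_toDisk_rotation, em, mul_assoc])
    (by rw [coe_toDisk_rotation, coe_toDisk_rotation, el, mul_assoc])
    (bounds m hm0 hmn).1 (bounds m hm0 hmn).2 (bounds l hl0 hln).1 (bounds l hl0 hln).2
  rw [dist_rotation] at this
  refine le_trans (sub_le_sub_right ?_ _) this
  have e : 2 * Real.pi * (m : ℝ) / n - 2 * Real.pi * (l : ℝ) / n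
      = 2 * Real.pi / n * ((m : ℝ) - l) := by ring
  have h1 : (1 : ℝ) ≤ |(m : ℝ) - l| := by
    have : (1 : ℤ) ≤ |(m : ℤ) - l| := Int.one_le_abs (by omega)
    exact_mod_cast this
  rw [e, abs_mul, abs_of_pos (by positivity)]
  have h2 := mul_le_mul_of_nonneg_left h1 (by positivity : 0 ≤ Real.pi / n)
  calc Real.pi / n = Real.pi / n * 1 := (mul_one _).symm
    _ ≤ Real.pi / n * |(m : ℝ) - l| := h2
    _ = 2 * Real.pi / n * |(m : ℝ) - l| / 2 := by ring

end RegularPolygon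

/-! ### Disks of given area -/

lemma exists_radius {ε : ℝ} (hε : 0 < ε) :
    ∃ ρ : ℝ, 0 < ρ ∧ 2 * Real.pi * (Real.cosh ρ - 1) = ε := by
  have hpi := Real.pi_pos
  have h1 : 1 ≤ 1 + ε / (2 * Real.pi) := by
    have : 0 < ε / (2 * Real.pi) := by positivity
    linarith
  obtain ⟨ρ, hρ, e⟩ := Real.cosh_surjOn (Set.mem_Ici.2 h1)
  refine ⟨ρ, lt_of_le_of_ne hρ ?_, by rw [e]; field_simp; ring⟩
  rintro rfl
  have : 0 < ε / (2 * Real.pi) := by positivity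
  rw [Real.cosh_zero] at e
  linarith

/-- A ball of nonpositive radius is contained in the disk of area `ε / 2`. -/
lemma radius_pos_of_volume_eq {c : ℍ} {ρ ε : ℝ} (hε : 0 < ε)
    (h : MeasureTheory.volume (Metric.closedBall c ρ) = ENNReal.ofReal ε) : 0 < ρ := by
  by_contra hρ
  obtain ⟨r, hr, e⟩ := exists_radius (half_pos hε)
  have := MeasureTheory.measure_mono (μ := MeasureTheory.volume)
    (Metric.closedBall_subset_closedBall (x := c) (by linarith : ρ ≤ r))
  rw [h, volume_closedBall c hr, e, ENNReal.ofReal_le_ofReal_iff (by positivity)] at this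
  linarith

/-- The area is `4π sinh² (ρ / 2)`, and `tanh² ≤ sinh²`. -/
lemma pi_mul_tanh_sq_lt_area {ρ : ℝ} (hρ : 0 < ρ) :
    Real.pi * Real.tanh (ρ / 2) ^ 2 < 2 * Real.pi * (Real.cosh ρ - 1) := by
  have hs : 0 < Real.sinh (ρ / 2) := Real.sinh_pos_iff.2 (half_pos hρ)
  have hc := Real.one_le_cosh (ρ / 2)
  have e : Real.cosh ρ - 1 = 2 * Real.sinh (ρ / 2) ^ 2 := by
    have : Real.cosh ρ = Real.cosh (2 * (ρ / 2)) := by ring_nf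
    rw [this, Real.cosh_two_mul, Real.cosh_sq]; ring
  have ht : Real.tanh (ρ / 2) ^ 2 ≤ Real.sinh (ρ / 2) ^ 2 := by
    rw [Real.tanh_eq_sinh_div_cosh, div_pow]
    exact div_le_self (sq_nonneg _) (one_le_pow₀ hc)
  rw [e]
  have hp : 0 < Real.pi * Real.sinh (ρ / 2) ^ 2 := mul_pos Real.pi_pos (pow_pos hs 2)
  have := mul_le_mul_of_nonneg_left ht Real.pi_pos.le
  linarith

lemma sphere_nonempty (c : ℍ) {ρ : ℝ} (hρ : 0 < ρ) : (Metric.sphere c ρ).Nonempty := by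
  -- On a vertical geodesic the distance is the difference of the logarithms of the heights.
  let z : ℍ := ⟨⟨c.re, c.im * Real.exp ρ⟩, mul_pos c.im_pos (Real.exp_pos ρ)⟩
  have hz : z.re = c.re := rfl
  refine ⟨z, ?_⟩
  rw [Metric.mem_sphere, UpperHalfPlane.dist_of_re_eq hz]
  change dist (Real.log (c.im * Real.exp ρ)) _ = _
  rw [Real.log_mul c.im_pos.ne' (Real.exp_pos ρ).ne', Real.log_exp, Real.dist_eq,
    add_sub_cancel_left, abs_of_pos hρ]

/-- A regular polygon in a disk of area `ε` has all its angles above `π / n - ε`. -/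
lemma regularPolygon_angles {n : ℕ} {c p : ℍ} {ρ ε : ℝ} (hε : 0 < ε)
    (h : MeasureTheory.volume (Metric.closedBall c ρ) = ENNReal.ofReal ε)
    (hp : p ∈ Metric.sphere c ρ) :
    regularPolygon n c p ∈ configurations n ∧ regularPolygon n c p ⊆ Metric.sphere c ρ ∧
      ∀ θ ∈ angles (regularPolygon n c p), Real.pi / n - ε < θ := by
  have hρ := radius_pos_of_volume_eq hε h
  have hd : dist p c = ρ := hp
  have hpc : p ≠ c := dist_pos.1 (hd ▸ hρ)
  have hlt := pi_mul_tanh_sq_lt_area hρ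
  have e : 2 * Real.pi * (Real.cosh ρ - 1) = ε := by
    rw [volume_closedBall c hρ, ENNReal.ofReal_eq_ofReal_iff _ hε.le] at h
    · exact h
    · have := Real.one_le_cosh ρ
      exact mul_nonneg (by positivity) (by linarith)
  refine ⟨regularPolygon_mem_configurations hpc, hd ▸ regularPolygon_subset_sphere n c p,
    fun θ hθ => ?_⟩
  have := angle_regularPolygon_ge hpc hθ
  rw [hd] at this
  linarith

/-! ### Minimal angles and their supremum -/

lemma finite_of_mem_configurations {n : ℕ} {C : Set ℍ} (hC : C ∈ configurations n) :
    C.Finite := by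
  apply Set.finite_of_encard_eq_coe (k := n) hC

lemma exists_mem_angles_lt {n : ℕ} (hn : 3 ≤ n) {C : Set ℍ} (hC : C ∈ configurations n) :
    ∃ θ ∈ angles C, θ < Real.pi / n := by
  have hfin := finite_of_mem_configurations hC
  have hcard : hfin.toFinset.card = n := by
    have h : C.encard = n := hC
    rw [hfin.encard_eq_coe_toFinset_card] at h
    exact_mod_cast h
  obtain ⟨p, hp, q, hq, r, hr, hpq, hrq, hpr, h⟩ := exists_angle_lt hn _ hcard
  rw [Set.Finite.mem_toFinset] at hp hq hr
  exact ⟨_, ⟨p, hp, q, hq, r, hr, hpq, hrq, hpr, rfl⟩, h⟩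

/-- The set of angles is finite and nonempty, so the infimum in `minAngle` is a true minimum and not
the default value `0` of `sInf`. -/
lemma isLeast_minAngle {n : ℕ} (hn : 3 ≤ n) {C : Set ℍ} (hC : C ∈ configurations n) :
    IsLeast (angles C) (minAngle C) := by
  have hfin := finite_of_mem_configurations hC
  have hA : (angles C).Finite := by
    refine ((hfin.prod (hfin.prod hfin)).image
      fun x : ℍ × ℍ × ℍ => angle x.1 x.2.1 x.2.2).subset ?_
    rintro _ ⟨p, hp, q, hq, r, hr, -, -, -, rfl⟩
    exact ⟨(p, q, r), ⟨hp, hq, hr⟩, rfl⟩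
  obtain ⟨θ, hθ, -⟩ := exists_mem_angles_lt hn hC
  exact ⟨Set.Nonempty.csInf_mem ⟨θ, hθ⟩ hA, fun x hx => csInf_le hA.bddBelow hx⟩

lemma minAngle_lt {n : ℕ} (hn : 3 ≤ n) {C : Set ℍ} (hC : C ∈ configurations n) :
    minAngle C < Real.pi / n := by
  obtain ⟨θ, hθ, hlt⟩ := exists_mem_angles_lt hn hC
  exact ((isLeast_minAngle hn hC).2 hθ).trans_lt hlt

lemma exists_disk (c : ℍ) {ε : ℝ} (hε : 0 < ε) :
    ∃ ρ : ℝ, 0 < ρ ∧ MeasureTheory.volume (Metric.closedBall c ρ) = ENNReal.ofReal ε ∧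
      (Metric.sphere c ρ).Nonempty := by
  obtain ⟨ρ, hρ, e⟩ := exists_radius hε
  exact ⟨ρ, hρ, by rw [volume_closedBall c hρ, e], sphere_nonempty c hρ⟩

lemma isLUB_minAngle {n : ℕ} (hn : 3 ≤ n) :
    IsLUB (minAngle '' configurations n) (Real.pi / n) := by
  constructor
  · rintro _ ⟨C, hC, rfl⟩
    exact (minAngle_lt hn hC).le
  · intro b hb
    by_contra! hlt
    -- For an upper bound `b` below `π / n`, a polygon in a disk of area `π / n - b` has minimal
    -- angle above `b`.
    obtain ⟨ρ, -, hvol, p, hp⟩ := exists_disk UpperHalfPlane.I (sub_pos.2 hlt)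
    obtain ⟨hC, -, hang⟩ := regularPolygon_angles (n := n) (sub_pos.2 hlt) hvol hp
    have h1 := hang _ (isLeast_minAngle hn hC).1
    have h2 := hb ⟨_, hC, rfl⟩
    linarith

end HypPlane

end

theorem mainTheorem2 (n : ℕ) (hn : 3 ≤ n) :
    (∀ C ∈ HypPlane.configurations n,
      IsLeast (HypPlane.angles C) (HypPlane.minAngle C) ∧
        HypPlane.minAngle C < Real.pi / n) ∧
    (∀ ε : ℝ, 0 < ε → ∀ c : UpperHalfPlane,
      (∃ ρ : ℝ, 0 < ρ ∧ MeasureTheory.volume (Metric.closedBall c ρ) = ENNReal.ofReal ε ∧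
        (Metric.sphere c ρ).Nonempty) ∧
      ∀ ρ : ℝ, MeasureTheory.volume (Metric.closedBall c ρ) = ENNReal.ofReal ε →
        ∀ p ∈ Metric.sphere c ρ,
          HypPlane.regularPolygon n c p ∈ HypPlane.configurations n ∧
          HypPlane.regularPolygon n c p ⊆ Metric.sphere c ρ ∧
          ∀ θ ∈ HypPlane.angles (HypPlane.regularPolygon n c p), Real.pi / n - ε < θ) ∧
    IsLUB (HypPlane.minAngle '' HypPlane.configurations n) (HypPlane.alpha n) ∧
    HypPlane.alpha n = Real.pi / n ∧
    ¬ ∃ C ∈ HypPlane.configurations n, HypPlane.minAngle C = HypPlane.alpha n := by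
  have hlub := HypPlane.isLUB_minAngle hn
  -- The empty set has no least upper bound in `ℝ`, so `hlub` itself gives the nonemptiness that
  -- rules out a default value of `sSup`.
  have halpha : HypPlane.alpha n = Real.pi / n := hlub.csSup_eq hlub.nonempty
  refine ⟨fun C hC => ⟨HypPlane.isLeast_minAngle hn hC, HypPlane.minAngle_lt hn hC⟩,
    fun ε hε c => ⟨HypPlane.exists_disk c hε, fun ρ h p hp =>
      HypPlane.regularPolygon_angles hε h hp⟩, halpha ▸ hlub, halpha, ?_⟩
  rintro ⟨C, hC, h⟩
  exact (HypPlane.minAngle_lt hn hC).ne (h.trans halpha)
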